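/- **Setting.** Ambient isotopies of $X=\mathbb R^3,\mathbb R^4$ are continuous families of homeomorphisms $H_u$ of $X$, $u\in[0,1]$, with $H_0=\mathrm{id}$; sets $A,B\subseteq X$ are ambient isotopic if $H_1(A)=B$ for one of them. A *polynomial knot* is an embedding $t\mapsto(f(t),g(t),h(t))$ of $\mathbb R$ in $\mathbb R^3$ (injective, with nowhere vanishing derivative) with $f,g,h\in\mathbb R[t]$. A *long 2-knot* is a proper smooth embedding $\mathbb R^2\to\mathbb R^4$ equal to $(x,y)\mapsto(x,y,0,0)$ outside a compact set; a *polynomial 2-knot* is a proper smooth embedding $\mathbb R^2\to\mathbb R^4$ with polynomial coordinates whose image is ambient isotopic to the image of a long 2-knot. The *spin* of a subset $k$ of $\{(x,y,z)\in\mathbb R^3: z\ge 0\}$ is $\{(x,y,z\cos\theta,z\sin\theta) : (x,y,z)\in k,\ 0\le\theta\le2\pi\}\subset\mathbb R^4$. The *Chebyshev approximation* of degree $n\geq 1$ of a function on $[\alpha,\beta]$ is the polynomial of degree at most $n$ that interpolates it in the $n+1$ Chebyshev points $\frac{\alpha+\beta}2-\frac{\beta-\alpha}2\cos\frac{j\pi}n$,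 $0\le j\le n$. **Theorem 5 (Construction II).** Let $K=\{(f(t),g(t),h(t)): t\in\mathbb R\}$ be a polynomial knot. Then there are $f_1,g_1,h_1\in\mathbb R[t]$, $a\in\mathbb R$ and a polynomial 2-knot $P:\mathbb R^2\to\mathbb R^4$ with the following properties. 1. (*Knotted arc of $K$ with one end at infinity.*) $(f_1,g_1,h_1)$ is a polynomial knot whose image is ambient isotopic to $K$. Moreover $h_1(a)=0$, $h_1'(a)\ne0$, $h_1(t)>0$ for $t>a$ and $h_1(t)\to\infty$ as $t\to\infty$, so that the arc $k=\{(f_1(t),g_1(t),h_1(t)): t\ge a\}$ lies in the upper half space, meets the plane $z=0$ transversely and in its endpoint only, and goes to infinity. The union of $k$ and the vertical ray $\{(f_1(a),g_1(a),z): z\le 0\}$ is ambient isotopic to $K$. 2. (*Spinning.*) The spin of $k$ is ambient isotopic in $\mathbb R^4$ to the image of $P$. 3. (*Polynomial parametrization.*) For every $\varepsilon>0$ there is an $N$ such that for all $n\ge N$ the Chebyshev approximations $S$ and $C$ of degree $n$ of $\sin$ and $\cos$ on $[0,2\pi]$ satisfy $|S(s)-\sin s|<\varepsilon$ and $|C(s)-\cos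 s|<\varepsilon$ for all $s\in[0,2\pi]$, and the map $$\psi':[a,\infty)\times[0,2\pi]\to\mathbb R^4,\qquad \psi'(t,s)=\bigl(f_1(t),\,g_1(t),\,h_1(t)S(s),\,h_1(t)C(s)\bigr)$$ parametrizes this knotted plane: $\psi'(t,s)=\psi'(t',s')$ if and only if $t=t'$ and ($t=a$ or $s=s'$ or $\{s,s'\}=\{0,2\pi\}$), and the image of $\psi'$ is ambient isotopic in $\mathbb R^4$ to the spin of $k$ (and hence to the image of $P$). -/

import Mathlib

open Polynomial Set Filter Topology
open scoped ContDiff unitInterval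

noncomputable section

/-- Two subsets `A`, `B` of a space `X` are ambient isotopic: there is a continuous family of
homeomorphisms of `X`, indexed by `[0,1]` and starting at the identity, whose last member carries
`A` onto `B`. -/
def AmbientIsotopic {X : Type*} [TopologicalSpace X] (A B : Set X) : Prop :=
  ∃ H : I × X → X, Continuous H ∧ (∀ u : I, IsHomeomorph fun x => H (u, x)) ∧
    (∀ x, H (0, x) = x) ∧ (fun x => H (1, x)) '' A = B

/-- The curve `t ↦ (f t, g t, h t)` in `ℝ³`. -/
def polyCurve (f g h : ℝ[X]) (t : ℝ) : EuclideanSpace ℝ (Fin 3) :=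
  !₂[f.eval t, g.eval t, h.eval t]

/-- `(f, g, h)` is a polynomial knot: `t ↦ (f t, g t, h t)` is an embedding of `ℝ` in `ℝ³`, that is,
injective with nowhere vanishing derivative (properness is automatic for polynomials). -/
structure IsPolynomialKnot (f g h : ℝ[X]) : Prop where
  injective : Function.Injective (polyCurve f g h)
  immersion : ∀ t : ℝ, polyCurve (derivative f) (derivative g) (derivative h) t ≠ 0

/-- The arc `{(f t, g t, h t) | a ≤ t}`. -/
def polyArc (f g h : ℝ[X]) (a : ℝ) : Set (EuclideanSpace ℝ (Fin 3)) :=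
  polyCurve f g h '' Ici a

/-- The vertical ray that leaves the point `p` downwards (in the direction of the negative third
axis). -/
def downwardRay (p : EuclideanSpace ℝ (Fin 3)) : Set (EuclideanSpace ℝ (Fin 3)) :=
  {q | q 0 = p 0 ∧ q 1 = p 1 ∧ q 2 ≤ p 2}

/-- The arc `t ↦ (f t, g t, h t)`, `a ≤ t`, of the polynomial knot `(f, g, h)` lies in the upper
half space `{z ≥ 0}`, meets the boundary plane `{z = 0}` only in its endpoint and transversely
there, and goes to infinity at the other end. -/
structure IsHalfSpaceArc (f g h : ℝ[X]) (a : ℝ) : Prop where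
  knot : IsPolynomialKnot f g h
  endpoint : h.eval a = 0
  positive : ∀ t : ℝ, a < t → 0 < h.eval t
  transverse : (derivative h).eval a ≠ 0
  infinite : Tendsto (fun t : ℝ => h.eval t) atTop atTop

/-- A half space arc is a knotted arc of the long knot `K ⊆ ℝ³`: it belongs to a polynomial
representation of the knot type of `K`, and it carries the whole of the knot, in the sense that
closing it off below the boundary plane by a straight ray gives the knot type of `K` again. -/
structure IsKnottedArcOf (f g h : ℝ[X]) (a : ℝ) (K : Set (EuclideanSpace ℝ (Fin 3))) : Prop where
  arc : IsHalfSpaceArc f g h a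
  representation : AmbientIsotopic (range (polyCurve f g h)) K
  closing : AmbientIsotopic (polyArc f g h a ∪ downwardRay (polyCurve f g h a)) K

/-- The surface swept out by a subset `k` of the upper half space `{(x, y, z, 0) | z ≥ 0}` that is
rotated in `ℝ⁴` by the full angle about the plane `{(x, y, 0, 0)}`. -/
def spin (k : Set (EuclideanSpace ℝ (Fin 3))) : Set (EuclideanSpace ℝ (Fin 4)) :=
  {q | ∃ p ∈ k, ∃ θ ∈ Icc (0 : ℝ) (2 * Real.pi),
    q = !₂[p 0, p 1, p 2 * Real.cos θ, p 2 * Real.sin θ]}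

/-- The map `(t, s) ↦ (f t, g t, h t * S s, h t * C s)`. -/
def spinParam (f g h S C : ℝ[X]) (x : ℝ × ℝ) : EuclideanSpace ℝ (Fin 4) :=
  !₂[f.eval x.1, g.eval x.1, h.eval x.1 * S.eval x.2, h.eval x.1 * C.eval x.2]

/-- A smooth embedding: a smooth immersion that is a proper embedding (a homeomorphism onto a closed
subset). -/
structure IsProperSmoothEmbedding
    (φ : EuclideanSpace ℝ (Fin 2) → EuclideanSpace ℝ (Fin 4)) : Prop where
  smooth : ContDiff ℝ ∞ φ
  immersion : ∀ x, Function.Injective (fderiv ℝ φ x)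
  proper : IsClosedEmbedding φ

/-- A long 2-knot: a proper smooth embedding of `ℝ²` in `ℝ⁴` that is the standard one outside a
compact region. -/
structure IsLongTwoKnot
    (φ : EuclideanSpace ℝ (Fin 2) → EuclideanSpace ℝ (Fin 4)) : Prop where
  embedding : IsProperSmoothEmbedding φ
  standard : ∃ D : Set (EuclideanSpace ℝ (Fin 2)), IsCompact D ∧
    ∀ x, x ∉ D → φ x = !₂[x 0, x 1, 0, 0]

/-- A polynomial 2-knot: a proper smooth embedding of `ℝ²` in `ℝ⁴` with polynomial coordinates that
represents a long 2-knot, up to ambient isotopy (a polynomial map that agrees with the standard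
embedding near infinity would be the standard embedding). -/
structure IsPolynomialTwoKnot
    (φ : EuclideanSpace ℝ (Fin 2) → EuclideanSpace ℝ (Fin 4)) : Prop where
  polynomial : ∃ p : Fin 4 → MvPolynomial (Fin 2) ℝ,
    ∀ x i, φ x i = MvPolynomial.eval (fun j => x j) (p i)
  embedding : IsProperSmoothEmbedding φ
  long : ∃ L, IsLongTwoKnot L ∧ AmbientIsotopic (range φ) (range L)

/-- The `j`-th of the `n + 1` Chebyshev points (of the second kind, so the endpoints are among them)
of the interval `[α, β]`, in increasing order: the affine images of the extremal points
`cos (j π / n)` of the Chebyshev polynomial of degree `n`; meant for `n ≥ 1` and `0 ≤ j ≤ n`. -/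
def chebyshevPoint (α β : ℝ) (n j : ℕ) : ℝ :=
  (α + β) / 2 - (β - α) / 2 * Polynomial.Chebyshev.node n j

/-- The Chebyshev approximation of degree `n` of a function `u` on `[α, β]`: the polynomial of
degree at most `n` that interpolates `u` in the `n + 1` Chebyshev points of the interval. -/
def chebyshevApprox (u : ℝ → ℝ) (α β : ℝ) (n : ℕ) : ℝ[X] :=
  Lagrange.interpolate (Finset.range (n + 1)) (chebyshevPoint α β n)
    (fun j => u (chebyshevPoint α β n j))

end

/-! The arc. Project the knot to a plane so that only finitely many parameters `D` belong to double
points or singular points; resultants of divided differences show that almost every direction in a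
pencil will do (`finite_setOf_infinite_common_zeros`). A change of heights that agrees at all
parameters over each double point descends to a continuous function on the plane, so a vertical
shear realises it (`AmbientIsotopic.range_of_heights`). Hence only the heights on `D` matter. With
`a` to the left of `D`, interpolation gives a positive polynomial `m` such that `(t - a) m(t)²`
equals the old height plus a constant on `D`. This new height changes sign only at `a`, and the part
`t ≤ a`, which contains no crossing parameter, can be straightened to a ray.

The 2-knot. The square in the height is what makes the spin polynomial. The spin is a surface of
revolution with radius `τ m²`, where `τ = t - a`. A homeomorphism that acts on radii by a square
root, up to scale, turns the radius into a multiple of `√τ m`; with `τ = x² + y²` the surface then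
has coordinates `x m`, `y m`, `-f`, `-g`, up to a factor on the first two. As `m` is eventually
nondecreasing, the surface is far out a graph over the radius and can be flattened there to a plane,
which yields a long 2-knot (`exists_isLongTwoKnot_of_revolutionSurface`).

The parametrization. By Rolle's theorem the derivative of a Chebyshev approximation interpolates the
derivative of the function, so the error has a small Lipschitz constant. It vanishes at `0` and
`2π`, which are nodes; it is therefore a function on the circle and extends radially to a
contraction `e` of `ℝ⁴`. The map `x ↦ x + e x` is injective, is joined to the identity by
homeomorphisms, and carries the exact spin to the approximate one, so the identifications are the
same. -/

/-! ### Ambient isotopies: shears and small perturbations of the identity -/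

namespace AmbientIsotopic

variable {X : Type*} [TopologicalSpace X]

theorem refl (A : Set X) : AmbientIsotopic A A :=
  ⟨fun p => p.2, continuous_snd, fun _ => IsHomeomorph.id, fun _ => rfl, by simp⟩

theorem trans {A B C : Set X} (hAB : AmbientIsotopic A B) (hBC : AmbientIsotopic B C) :
    AmbientIsotopic A C := by
  obtain ⟨H, hc, hh, h0, rfl⟩ := hAB
  obtain ⟨K, kc, kh, k0, rfl⟩ := hBC
  refine ⟨fun p => K (p.1, H p), by fun_prop, fun u => (kh u).comp (hh u), ?_, ?_⟩
  · intro x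
    simp [h0, k0]
  · simp [image_image]

theorem symm {A B : Set X} (hAB : AmbientIsotopic A B) : AmbientIsotopic B A := by
  obtain ⟨H, hc, hh, h0, rfl⟩ := hAB
  let e : X ≃ₜ X := (hh 1).homeomorph
  have he : ∀ x, e x = H (1, x) := fun x => rfl
  refine ⟨fun p => H (unitInterval.symm p.1, e.symm p.2), ?_, ?_, ?_, ?_⟩
  · have := e.symm.continuous
    fun_prop
  · intro u
    exact (hh (unitInterval.symm u)).comp e.symm.isHomeomorph
  · intro x
    simp [← he]
  · simp only [image_image, unitInterval.symm_one, h0]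
    simp [← he]

/-- A displacement `e` that does not change along its own direction gives an isotopy. -/
theorem of_shear {V : Type*} [AddCommGroup V] [Module ℝ V] [TopologicalSpace V]
    [IsTopologicalAddGroup V] [ContinuousSMul ℝ V] (e : V → V) (he : Continuous e)
    (hinv : ∀ (c : ℝ) x, e (x + c • e x) = e x) {A B : Set V}
    (hAB : (fun x => x + e x) '' A = B) : AmbientIsotopic A B := by
  have hs : ∀ c : ℝ, IsHomeomorph fun x => x + c • e x := by
    intro c
    let φ : V ≃ₜ V :=
      { toFun := fun x => x + c • e x
        invFun := fun x => x + (-c) • e x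
        left_inv := fun x => by
          simp only [hinv c x]
          simp
        right_inv := fun x => by
          simp only [hinv (-c) x]
          simp
        continuous_toFun := by fun_prop
        continuous_invFun := by fun_prop }
    exact φ.isHomeomorph
  refine ⟨fun p => p.2 + (p.1 : ℝ) • e p.2, by fun_prop, fun u => hs u, by simp, ?_⟩
  simpa using hAB

/-- The identity plus a contraction gives an isotopy. -/
theorem of_contraction {V : Type*} [NormedAddCommGroup V] [NormedSpace ℝ V] [CompleteSpace V]
    (e : V → V) {K : NNReal} (hK : K < 1) (he : LipschitzWith K e) {A B : Set V}
    (hAB : (fun x => x + e x) '' A = B) : AmbientIsotopic A B := by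
  have hs : ∀ u : I, IsHomeomorph fun x => x + (u : ℝ) • e x := by
    intro u
    have happ : ApproximatesLinearOn (fun x => x + (u : ℝ) • e x)
        ((ContinuousLinearEquiv.refl ℝ V : V ≃L[ℝ] V) : V →L[ℝ] V) univ K := by
      intro x _ y _
      have h1 : x + (u : ℝ) • e x - (y + (u : ℝ) • e y) - (x - y) = (u : ℝ) • (e x - e y) := by
        rw [smul_sub]; abel
      simp only [ContinuousLinearEquiv.coe_refl, ContinuousLinearMap.coe_id', id]
      rw [h1, norm_smul, Real.norm_of_nonneg u.2.1]
      calc (u : ℝ) * ‖e x - e y‖ ≤ 1 * ‖e x - e y‖ := by gcongr; exact u.2.2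
        _ ≤ K * ‖x - y‖ := by simpa using he.norm_sub_le x y
    have hc : Subsingleton V ∨ K <
        ‖((ContinuousLinearEquiv.refl ℝ V).symm : V →L[ℝ] V)‖₊⁻¹ := by
      rcases subsingleton_or_nontrivial V with h | h
      · exact Or.inl h
      · right
        simpa using hK
    exact (happ.toHomeomorph _ hc).isHomeomorph
  have := he.continuous
  refine ⟨fun p => p.2 + (p.1 : ℝ) • e p.2, by fun_prop, fun u => hs u, by simp, ?_⟩
  simpa using hAB

end AmbientIsotopic

theorem Continuous.vec3 {X : Type*} [TopologicalSpace X] {f g h : X → ℝ} (hf : Continuous f)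
    (hg : Continuous g) (hh : Continuous h) :
    Continuous fun x => (!₂[f x, g x, h x] : EuclideanSpace ℝ (Fin 3)) := by
  refine (PiLp.continuous_toLp 2 _).comp (continuous_pi fun i => ?_)
  fin_cases i <;> simpa

theorem Continuous.vec4 {X : Type*} [TopologicalSpace X] {f g h k : X → ℝ} (hf : Continuous f)
    (hg : Continuous g) (hh : Continuous h) (hk : Continuous k) :
    Continuous fun x => (!₂[f x, g x, h x, k x] : EuclideanSpace ℝ (Fin 4)) := by
  refine (PiLp.continuous_toLp 2 _).comp (continuous_pi fun i => ?_)
  fin_cases i <;> simpa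

/-! ### Changing heights over a plane projection -/

/-- A function on the source of a proper map that is constant on the fibres extends to the
target. -/
theorem exists_continuous_factor {Y : Type*} [TopologicalSpace Y] [NormalSpace Y]
    {π : ℝ → Y} (hπ : Continuous π) (hcl : IsClosedMap π)
    {δ : ℝ → ℝ} (hδ : Continuous δ) (hfac : ∀ s t, π s = π t → δ s = δ t) :
    ∃ φ : Y → ℝ, Continuous φ ∧ ∀ t, φ (π t) = δ t := by
  -- A closed continuous map is a quotient map onto its closed image, so `δ` descends to the image;
  -- Tietze's theorem extends it to `Y`.
  have hq : IsQuotientMap (rangeFactorization π) := by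
    refine IsClosedMap.isQuotientMap ?_ hπ.rangeFactorization rangeFactorization_surjective
    intro A hA
    refine ⟨⟨(π '' A)ᶜ, (hcl A hA).isOpen_compl, ?_⟩⟩
    ext ⟨y, hy⟩
    simp only [mem_preimage, mem_compl_iff, mem_image, Subtype.ext_iff, rangeFactorization_coe]
  let l : C(range π, ℝ) := IsQuotientMap.lift (f := ⟨rangeFactorization π, hπ.rangeFactorization⟩)
    hq ⟨δ, hδ⟩ (fun s t hst => hfac s t (congrArg Subtype.val hst))
  obtain ⟨Φ, hΦ⟩ := ContinuousMap.exists_restrict_eq (hcl.isClosed_range) l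
  refine ⟨Φ, Φ.continuous, fun t => ?_⟩
  have h1 : Φ (π t) = (Φ.restrict (range π)) (rangeFactorization π t) := rfl
  rw [h1, hΦ]
  exact congrArg (fun F : C(ℝ, ℝ) => F t) (IsQuotientMap.lift_comp
    (f := ⟨rangeFactorization π, hπ.rangeFactorization⟩) hq ⟨δ, hδ⟩
    (fun s t hst => hfac s t (congrArg Subtype.val hst)))

/-- The heights of the points of a curve can be changed by an ambient isotopy, as long as the points
over a double point of the projection are moved by the same amount. -/
theorem AmbientIsotopic.range_of_heights {f g h h' : ℝ → ℝ} (hf : Continuous f) (hg : Continuous g)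
    (hh : Continuous h) (hh' : Continuous h') (hcl : IsClosedMap fun t => (f t, g t))
    (hfac : ∀ s t, f s = f t → g s = g t → h' s - h s = h' t - h t) :
    AmbientIsotopic (range fun t => (!₂[f t, g t, h t] : EuclideanSpace ℝ (Fin 3)))
      (range fun t => (!₂[f t, g t, h' t] : EuclideanSpace ℝ (Fin 3))) := by
  obtain ⟨φ, hφ, hφδ⟩ := exists_continuous_factor (π := fun t => (f t, g t)) (by fun_prop) hcl
    (δ := fun t => h' t - h t) (by fun_prop)
    (fun s t hst => hfac s t (congrArg Prod.fst hst) (congrArg Prod.snd hst))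
  refine AmbientIsotopic.of_shear (fun x => !₂[0, 0, φ (x 0, x 1)]) ?_ ?_ ?_
  · exact Continuous.vec3 (by fun_prop) (by fun_prop) (by fun_prop)
  · intro c x
    simp
  · rw [← range_comp]
    congr 1
    funext t
    ext i
    fin_cases i <;> simp [hφδ]

/-- A plane curve is closed (and properly parametrized) if its second coordinate is a nonconstant
polynomial. -/
theorem isClosedMap_prodMk_eval {f : ℝ → ℝ} (hf : Continuous f) {g : ℝ[X]} (hg : 0 < g.degree) :
    IsClosedMap fun t => (f t, g.eval t) := by
  have hp : IsProperMap (Prod.snd ∘ fun t => (f t, g.eval t)) := g.isProperMap_eval hg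
  exact (isProperMap_of_comp_of_t2 (by fun_prop) continuous_snd hp).isClosedMap

/-! ### Generic projections: resultants and divided differences -/

namespace Polynomial

open scoped Polynomial.Bivariate

/-- An irreducible monic bivariate polynomial that does not divide `A` has common zeros with `A`
over finitely many abscissas only. -/
theorem finite_common_zeros_of_not_dvd {Q A : ℝ[X][Y]} (hQ : Irreducible Q) (hm : Q.Monic)
    (hA : ¬ Q ∣ A) : {s : ℝ | ∃ t, A.evalEval s t = 0 ∧ Q.evalEval s t = 0}.Finite := by
  let K := FractionRing ℝ[X]
  have hinj : Function.Injective (algebraMap ℝ[X] K) := IsFractionRing.injective _ _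
  have hQK : Irreducible (Q.map (algebraMap ℝ[X] K)) :=
    (hm.irreducible_iff_irreducible_map_fraction_map).1 hQ
  -- By Gauss's lemma `Q` stays irreducible over the fraction field, where not dividing means being
  -- coprime; hence the resultant is nonzero.
  have hcop : IsCoprime (Q.map (algebraMap ℝ[X] K)) (A.map (algebraMap ℝ[X] K)) := by
    rw [hQK.coprime_iff_not_dvd, map_dvd_map _ hinj hm]
    exact hA
  have hr : resultant Q A ≠ 0 := by
    have h1 := resultant_ne_zero _ _ hcop
    rw [natDegree_map_eq_of_injective hinj, natDegree_map_eq_of_injective hinj,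
      resultant_map_map] at h1
    exact fun h => h1 (by rw [h, map_zero])
  have hdeg : Q.natDegree ≠ 0 := fun h =>
    hQ.not_isUnit (by rw [eq_one_of_monic_natDegree_zero hm h]; exact isUnit_one)
  -- The resultant is a combination of `Q` and `A`, so it vanishes at the abscissa of every common
  -- zero.
  obtain ⟨p, q, -, -, hpq⟩ := exists_mul_add_mul_eq_C_resultant (m := Q.natDegree)
    (n := A.natDegree) Q A le_rfl le_rfl (Or.inl hdeg)
  refine ((resultant Q A).rootSet_finite ℝ).subset ?_
  rintro s ⟨t, hAt, hQt⟩
  rw [mem_rootSet]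
  refine ⟨hr, ?_⟩
  have h2 := congrArg (evalEval s t) hpq
  rw [evalEval_add, evalEval_mul, evalEval_mul, hAt, hQt, evalEval_C] at h2
  simpa using h2.symm

/-- Let `F`, `G`, `H` be bivariate polynomials without common zeros, with `G` monic up to a unit.
For all but finitely many `c`, the polynomials `F + c H` and `G` have common zeros over finitely
many abscissas only. -/
theorem finite_setOf_infinite_common_zeros (F H G : ℝ[X][Y]) (hG : IsUnit G.leadingCoeff)
    (hFGH : ∀ s t : ℝ, G.evalEval s t = 0 → F.evalEval s t = 0 → H.evalEval s t ≠ 0) :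
    {c : ℝ | {s : ℝ | ∃ t, (F + CC c * H).evalEval s t = 0 ∧
      G.evalEval s t = 0}.Infinite}.Finite := by
  induction G using UniqueFactorizationMonoid.induction_on_prime with
  | h₁ => simp at hG
  | h₂ G hu =>
    convert finite_empty
    ext c
    simp only [mem_ofPred_eq, mem_empty_iff_false, iff_false, not_infinite]
    convert finite_empty
    ext s
    simp only [mem_ofPred_eq, mem_empty_iff_false, iff_false, not_exists, not_and]
    intro t _
    exact (hu.map (evalEvalRingHom s t)).ne_zero
  | h₃ G Q _ hQ ih =>
    rw [leadingCoeff_mul, IsUnit.mul_iff] at hG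
    have ih' := ih hG.2 fun s t h => hFGH s t (by rw [evalEval_mul, h, mul_zero])
    have hQbad : {c : ℝ | {s : ℝ | ∃ t, (F + CC c * H).evalEval s t = 0 ∧
        Q.evalEval s t = 0}.Infinite}.Finite := by
      obtain ⟨u, hu⟩ := hG.1
      let Q' : ℝ[X][Y] := C (↑u⁻¹ : ℝ[X]) * Q
      have hunit : IsUnit (C (↑u⁻¹ : ℝ[X]) : ℝ[X][Y]) := (u⁻¹).isUnit.map C
      have hass : Associated Q' Q := (associated_unit_mul_right Q _ hunit).symm
      have hm : Q'.Monic := by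
        rw [Monic, leadingCoeff_mul, leadingCoeff_C, ← hu, Units.inv_mul]
      have hirr : Irreducible Q' := hass.symm.irreducible hQ.irreducible
      have hzero : ∀ s t, Q.evalEval s t = 0 → Q'.evalEval s t = 0 := fun s t h => by
        rw [evalEval_mul, h, mul_zero]
      have hdvd : ∀ c, {s : ℝ | ∃ t, (F + CC c * H).evalEval s t = 0 ∧
          Q.evalEval s t = 0}.Infinite → Q ∣ F + CC c * H := by
        intro c hc
        by_contra hn
        refine hc ((finite_common_zeros_of_not_dvd hirr hm
          (fun h => hn (hass.symm.dvd.trans h))).subset ?_)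
        rintro s ⟨t, h1, h2⟩
        exact ⟨t, h1, hzero s t h2⟩
      -- A prime factor spoils at most one `c`: dividing `F + c H` and `F + d H` with `c ≠ d`, it
      -- divides `F` and `H`, and any zero of it is then a forbidden common zero.
      refine Set.Subsingleton.finite fun c hc d hd => ?_
      by_contra hne
      have h1 : Q ∣ CC (c - d) * H := by
        have := dvd_sub (hdvd c hc) (hdvd d hd)
        have h2 : F + CC c * H - (F + CC d * H) = CC (c - d) * H := by
          rw [CC, CC, CC, C_sub, C_sub]; ring
        rwa [h2] at this
      have h3 : Q ∣ H := by
        have h4 : IsUnit (CC (c - d) : ℝ[X][Y]) :=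
          ((isUnit_iff_ne_zero.2 (sub_ne_zero.2 hne)).map C).map C
        exact (h4.dvd_mul_left).1 h1
      have h5 : Q ∣ F := by
        have := dvd_sub (hdvd c hc) (h3.mul_left (CC c))
        rwa [add_sub_cancel_right] at this
      obtain ⟨s, t, -, hst⟩ := Set.Infinite.nonempty hc
      refine hFGH s t (by rw [evalEval_mul, hst, zero_mul]) ?_ ?_
      · exact zero_dvd_iff.1 (hst ▸ evalEval_dvd s t h5)
      · exact zero_dvd_iff.1 (hst ▸ evalEval_dvd s t h3)
    refine (hQbad.union ih').subset ?_
    intro c hc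
    by_contra hn
    simp only [mem_union, mem_ofPred_eq, not_or, not_infinite] at hn
    refine hc ((hn.1.union hn.2).subset ?_)
    rintro s ⟨t, h1, h2⟩
    rw [evalEval_mul, mul_eq_zero] at h2
    rcases h2 with h2 | h2
    · exact Or.inl ⟨t, h1, h2⟩
    · exact Or.inr ⟨t, h1, h2⟩

/-- The divided difference `(f(Y) - f(X)) / (Y - X)`. -/
noncomputable def dividedDiff (f : ℝ[X]) : ℝ[X][Y] :=
  f.map C /ₘ (Y - C X)

theorem dividedDiff_spec (f : ℝ[X]) : C f + (Y - C X) * dividedDiff f = f.map C := by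
  have h := modByMonic_add_div (f.map C) ((Y : ℝ[X][Y]) - C X)
  rw [modByMonic_X_sub_C_eq_C_eval] at h
  rw [dividedDiff]
  convert h using 3
  rw [eval_map, eval₂_C_X]

theorem eval_add_mul_dividedDiff (f : ℝ[X]) (s t : ℝ) :
    f.eval s + (t - s) * (dividedDiff f).evalEval s t = f.eval t := by
  have h := congrArg (evalEval s t) (dividedDiff_spec f)
  simpa [evalEval_add, evalEval_mul, evalEval_sub, evalEval_C, evalEval_X, evalEval_map_C] using h

theorem evalEval_dividedDiff_self (f : ℝ[X]) (s : ℝ) :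
    (dividedDiff f).evalEval s s = (derivative f).eval s := by
  have h := congrArg (fun p => evalEval s s (derivative p)) (dividedDiff_spec f)
  simpa [evalEval_add, evalEval_mul, evalEval_sub, evalEval_C, evalEval_X, evalEval_map_C,
    derivative_map] using h

theorem evalEval_dividedDiff_eq_zero_of_ne {f : ℝ[X]} {s t : ℝ} (hst : s ≠ t) :
    (dividedDiff f).evalEval s t = 0 ↔ f.eval s = f.eval t := by
  have h := eval_add_mul_dividedDiff f s t
  have h2 : t - s ≠ 0 := sub_ne_zero.2 hst.symm
  constructor
  · intro h3
    rw [h3] at h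
    simpa using h
  · intro h3
    rw [h3] at h
    simpa [h2] using h

theorem dividedDiff_add_C_mul (f h : ℝ[X]) (c : ℝ) :
    dividedDiff (f + C c * h) = dividedDiff f + CC c * dividedDiff h := by
  have hne : (Y : ℝ[X][Y]) - C X ≠ 0 := X_sub_C_ne_zero _
  apply mul_left_cancel₀ hne
  have h1 := dividedDiff_spec (f + C c * h)
  have h2 := dividedDiff_spec f
  have h3 := dividedDiff_spec h
  simp only [map_add, map_mul, Polynomial.map_add, Polynomial.map_mul, map_C] at h1 h2 h3 ⊢
  linear_combination h1 - h2 - (C (C c)) * h3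

theorem isUnit_leadingCoeff_dividedDiff {g : ℝ[X]} (hg : 0 < g.degree) :
    IsUnit (dividedDiff g).leadingCoeff := by
  have hinj : Function.Injective (C : ℝ → ℝ[X]) := C_injective
  rw [dividedDiff, leadingCoeff_divByMonic_X_sub_C _
    (by rw [degree_map_eq_of_injective hinj]; exact hg.ne'),
    leadingCoeff_map_of_injective hinj]
  exact (isUnit_iff_ne_zero.2 (leadingCoeff_ne_zero.2 (ne_zero_of_degree_gt hg))).map C

end Polynomial

/-- A generic projection of a polynomial knot to a plane has finitely many double points and
singular points: there is a finite set of parameters outside of which it is an injective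
immersion. -/
theorem exists_projection_finite_double_points {f g h : ℝ[X]} (hK : IsPolynomialKnot f g h)
    (hg : 0 < g.degree) : ∃ (c : ℝ) (D : Finset ℝ),
      (∀ s t, s ≠ t → (f + C c * h).eval s = (f + C c * h).eval t → g.eval s = g.eval t → s ∈ D) ∧
      ∀ s, (derivative (f + C c * h)).eval s = 0 → (derivative g).eval s = 0 → s ∈ D := by
  have hfin := finite_setOf_infinite_common_zeros (dividedDiff f) (dividedDiff h) (dividedDiff g)
    -- A zero common to the three divided differences would be a double point of the knot off the
    -- diagonal, and a point of zero velocity on it.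
    (isUnit_leadingCoeff_dividedDiff hg) (by
      intro s t h1 h2 h3
      by_cases hst : s = t
      · subst hst
        rw [evalEval_dividedDiff_self] at h1 h2 h3
        apply hK.immersion s
        ext i
        fin_cases i <;> simp [polyCurve, h1, h2, h3]
      · rw [evalEval_dividedDiff_eq_zero_of_ne hst] at h1 h2 h3
        apply hst
        apply hK.injective
        simp [polyCurve, h1, h2, h3])
  obtain ⟨c, hc⟩ := hfin.infinite_compl.nonempty
  simp only [mem_compl_iff, mem_ofPred_eq, not_infinite] at hc
  refine ⟨c, hc.toFinset, ?_, ?_⟩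
  · intro s t hst h1 h2
    rw [Set.Finite.mem_toFinset]
    refine ⟨t, ?_, (evalEval_dividedDiff_eq_zero_of_ne hst).2 h2⟩
    rw [← dividedDiff_add_C_mul]
    exact (evalEval_dividedDiff_eq_zero_of_ne hst).2 h1
  · intro s h1 h2
    rw [Set.Finite.mem_toFinset]
    refine ⟨s, ?_, (evalEval_dividedDiff_self _ _).trans h2⟩
    rw [← dividedDiff_add_C_mul]
    exact (evalEval_dividedDiff_self _ _).trans h1

/-! ### Interpolation by positive polynomials -/

namespace Polynomial

/-- Hermite interpolation with critical points at the nodes. -/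
theorem exists_eval_eq_and_derivative_eval_eq_zero (D : Finset ℝ) (v : ℝ → ℝ) :
    ∃ p : ℝ[X], ∀ s ∈ D, p.eval s = v s ∧ (derivative p).eval s = 0 := by
  classical
  have hinj : Set.InjOn (id : ℝ → ℝ) D := injOn_id _
  let p₀ := Lagrange.interpolate D id v
  let w := Lagrange.nodal D (id : ℝ → ℝ)
  let p₁ := Lagrange.interpolate D id
    fun s => -(derivative p₀).eval s / (derivative w).eval s
  -- At a node `w` vanishes, so the derivative there is `p₀' + w' p₁`, and `p₁` is chosen to cancel
  -- it.
  refine ⟨p₀ + w * p₁, fun s hs => ?_⟩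
  have hw : w.eval s = 0 := Lagrange.eval_nodal_at_node (v := id) hs
  have hw' : (derivative w).eval s ≠ 0 := by
    have h1 := Lagrange.eval_nodal_derivative_eval_node_eq (v := (id : ℝ → ℝ)) hs
    simp only [id] at h1
    rw [h1]
    exact Lagrange.eval_nodal_not_at_node fun j hj => (Finset.ne_of_mem_erase hj).symm
  have hp₀ : p₀.eval s = v s := Lagrange.eval_interpolate_at_node (v := id) v hinj hs
  have hp₁ : p₁.eval s = -(derivative p₀).eval s / (derivative w).eval s :=
    Lagrange.eval_interpolate_at_node (v := id) _ hinj hs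
  constructor
  · simp [hw, hp₀]
  · simp only [derivative_add, derivative_mul, eval_add, eval_mul, hw, hp₁]
    field_simp
    ring

/-- Interpolation by a positive polynomial with critical points at the nodes. -/
theorem exists_positive_eval_eq (D : Finset ℝ) (v : ℝ → ℝ) (hv : ∀ s ∈ D, 0 < v s) :
    ∃ m : ℝ[X], (∀ t, 0 < m.eval t) ∧
      (∀ s ∈ D, m.eval s = v s ∧ (derivative m).eval s = 0) ∧
      ∀ᶠ t in atTop, 1 ≤ m.eval t := by
  obtain ⟨p, hp⟩ := exists_eval_eq_and_derivative_eval_eq_zero D fun s => √(v s)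
  let w := Lagrange.nodal D (id : ℝ → ℝ)
  have hwD : ∀ s ∈ D, w.eval s = 0 := fun s hs => Lagrange.eval_nodal_at_node (v := id) hs
  have hw : ∀ t ∉ D, w.eval t ≠ 0 := fun t ht =>
    Lagrange.eval_nodal_not_at_node fun j hj h => ht (by rw [h]; exact hj)
  -- The first square carries the values at the nodes; the second vanishes there to second order and
  -- keeps the sum positive elsewhere.
  refine ⟨p ^ 2 + w ^ 2, fun t => ?_, fun s hs => ⟨?_, ?_⟩, ?_⟩
  · simp only [eval_add, eval_pow]
    by_cases ht : t ∈ D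
    · have : 0 < p.eval t := by
        rw [(hp t ht).1]
        exact Real.sqrt_pos.2 (hv t ht)
      positivity
    · have := hw t ht
      positivity
  · simp [hwD s hs, (hp s hs).1, Real.sq_sqrt (hv s hs).le]
  · simp [derivative_pow, hwD s hs, (hp s hs).2]
  · obtain ⟨T, hT⟩ := D.exists_le
    filter_upwards [eventually_ge_atTop (T + 1)] with t ht
    have h1 : 1 ≤ w.eval t := by
      rw [Lagrange.eval_nodal]
      exact Finset.one_le_prod fun i hi => by
        have := hT i hi
        simp only [id]
        linarith
    simp only [eval_add, eval_pow]
    nlinarith [sq_nonneg (p.eval t)]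

end Polynomial

/-! ### The knotted arc in the half space -/

theorem polyCurve_eq_iff {f g h : ℝ[X]} {s t : ℝ} : polyCurve f g h s = polyCurve f g h t ↔
    f.eval s = f.eval t ∧ g.eval s = g.eval t ∧ h.eval s = h.eval t := by
  constructor
  · intro hst
    exact ⟨congrArg (fun x => x 0) hst, congrArg (fun x => x 1) hst, congrArg (fun x => x 2) hst⟩
  · rintro ⟨h1, h2, h3⟩
    simp [polyCurve, h1, h2, h3]

theorem polyCurve_eq_zero_iff {f g h : ℝ[X]} {t : ℝ} : polyCurve f g h t = 0 ↔
    f.eval t = 0 ∧ g.eval t = 0 ∧ h.eval t = 0 := by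
  constructor
  · intro hst
    exact ⟨congrArg (fun x => x 0) hst, congrArg (fun x => x 1) hst, congrArg (fun x => x 2) hst⟩
  · rintro ⟨h1, h2, h3⟩
    ext i
    fin_cases i <;> simp [polyCurve, h1, h2, h3]

namespace IsPolynomialKnot

variable {f g h : ℝ[X]}

theorem add_fst (hK : IsPolynomialKnot f g h) (c : ℝ) : IsPolynomialKnot (f + C c * h) g h where
  injective s t hst := by
    rw [polyCurve_eq_iff] at hst
    obtain ⟨h1, h2, h3⟩ := hst
    refine hK.injective (polyCurve_eq_iff.2 ⟨?_, h2, h3⟩)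
    simpa [h3] using h1
  immersion t ht := by
    rw [polyCurve_eq_zero_iff] at ht
    obtain ⟨h1, h2, h3⟩ := ht
    refine hK.immersion t (polyCurve_eq_zero_iff.2 ⟨?_, h2, h3⟩)
    simpa [h3] using h1

theorem add_snd (hK : IsPolynomialKnot f g h) (b c : ℝ) :
    IsPolynomialKnot f (g + C b * f + C c * h) h where
  injective s t hst := by
    rw [polyCurve_eq_iff] at hst
    obtain ⟨h1, h2, h3⟩ := hst
    refine hK.injective (polyCurve_eq_iff.2 ⟨h1, ?_, h3⟩)
    simpa [h1, h3] using h2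
  immersion t ht := by
    rw [polyCurve_eq_zero_iff] at ht
    obtain ⟨h1, h2, h3⟩ := ht
    refine hK.immersion t (polyCurve_eq_zero_iff.2 ⟨h1, ?_, h3⟩)
    simpa [h1, h3] using h2

end IsPolynomialKnot

theorem ambientIsotopic_add_fst (f g h : ℝ[X]) (c : ℝ) :
    AmbientIsotopic (range (polyCurve f g h)) (range (polyCurve (f + C c * h) g h)) := by
  refine AmbientIsotopic.of_shear (fun x : EuclideanSpace ℝ (Fin 3) => !₂[c * x 2, 0, 0]) ?_ ?_ ?_
  · exact Continuous.vec3 (by fun_prop) (by fun_prop) (by fun_prop)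
  · intro c x
    simp
  · rw [← range_comp]
    congr 1
    funext t
    ext i
    fin_cases i <;> simp [polyCurve]

theorem ambientIsotopic_add_snd (f g h : ℝ[X]) (b c : ℝ) :
    AmbientIsotopic (range (polyCurve f g h))
      (range (polyCurve f (g + C b * f + C c * h) h)) := by
  refine AmbientIsotopic.of_shear
    (fun x : EuclideanSpace ℝ (Fin 3) => !₂[0, b * x 0 + c * x 2, 0]) ?_ ?_ ?_
  · exact Continuous.vec3 (by fun_prop) (by fun_prop) (by fun_prop)
  · intro c x
    simp
  · rw [← range_comp]
    congr 1
    funext t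
    ext i
    fin_cases i <;> simp [polyCurve, add_assoc]

theorem Polynomial.derivative_eq_zero_of_degree_le {f : ℝ[X]} (hf : ¬ 0 < f.degree) :
    derivative f = 0 := by
  rw [eq_C_of_degree_le_zero (not_lt.1 hf), derivative_C]

/-- A shear makes the second coordinate of a polynomial knot nonconstant. -/
theorem IsPolynomialKnot.exists_degree_snd_pos {f g h : ℝ[X]} (hK : IsPolynomialKnot f g h) :
    ∃ g₁, IsPolynomialKnot f g₁ h ∧ 0 < g₁.degree ∧
      AmbientIsotopic (range (polyCurve f g h)) (range (polyCurve f g₁ h)) := by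
  by_cases hg : 0 < g.degree
  · exact ⟨g, hK, hg, .refl _⟩
  have hg' := derivative_eq_zero_of_degree_le hg
  have key : ∃ b c : ℝ, 0 < (g + C b * f + C c * h).degree := by
    by_contra! hn
    have h1 := fun b c => derivative_eq_zero_of_degree_le (not_lt.2 (hn b c))
    have hf := h1 1 0
    have hh := h1 0 1
    simp only [derivative_add, hg', zero_mul, zero_add, C_1, C_0,
      one_mul, add_zero] at hf hh
    exact hK.immersion 0 (polyCurve_eq_zero_iff.2 (by simp [hf, hh, hg']))
  obtain ⟨b, c, hbc⟩ := key
  exact ⟨_, hK.add_snd b c, hbc, ambientIsotopic_add_snd f g h b c⟩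

/-- If the part `t ≤ a` of a curve is a graph over the lower half of the third axis, it can be
straightened to a vertical ray. -/
theorem ambientIsotopic_straighten_lower {f g h : ℝ[X]} {a : ℝ} (ha : h.eval a = 0)
    (hpos : ∀ t, a < t → 0 < h.eval t) :
    AmbientIsotopic
      (range fun t => (!₂[f.eval t, g.eval t, if t ≤ a then t - a else h.eval t] :
        EuclideanSpace ℝ (Fin 3)))
      (polyArc f g h a ∪ downwardRay (polyCurve f g h a)) := by
  -- At height `z ≤ 0` the curve sits over the parameter `a + z`; each horizontal slice is
  -- translated to bring that point over the endpoint. Above height `0` the displacement is zero.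
  refine AmbientIsotopic.of_shear (fun x : EuclideanSpace ℝ (Fin 3) => !₂[f.eval a - f.eval (a + min (x 2) 0),
    g.eval a - g.eval (a + min (x 2) 0), 0]) ?_ ?_ ?_
  · exact Continuous.vec3 (by fun_prop) (by fun_prop) (by fun_prop)
  · intro c x
    simp
  · rw [← range_comp]
    have hup : ∀ t, a ≤ t → (if t ≤ a then t - a else h.eval t) = h.eval t := by
      intro t ht
      rcases ht.eq_or_lt with rfl | ht
      · simp [ha]
      · simp [not_le.2 ht]
    have hnn : ∀ t, a ≤ t → 0 ≤ h.eval t := fun t ht => by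
      rcases ht.eq_or_lt with rfl | ht
      exacts [ha.ge, (hpos t ht).le]
    apply subset_antisymm
    · rintro _ ⟨t, rfl⟩
      rcases le_total a t with ht | ht
      · left
        refine ⟨t, ht, ?_⟩
        have := hnn t ht
        ext i
        fin_cases i <;> simp [polyCurve, hup t ht, this]
      · right
        have h2 : t - a ≤ 0 := by linarith
        simp [downwardRay, ht, polyCurve, ha, h2]
    · rintro x (⟨t, ht, rfl⟩ | hx)
      · refine ⟨t, ?_⟩
        have := hnn t ht
        ext i
        fin_cases i <;> simp [polyCurve, hup t ht, this]
      · obtain ⟨h0, h1, h2⟩ := hx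
        simp [polyCurve, ha] at h0 h1 h2
        refine ⟨a + x 2, ?_⟩
        ext i
        fin_cases i <;> simp [h0, h1, h2]

/-- Every polynomial knot has a knotted arc in the upper half space whose height is a linear factor
times the square of a positive polynomial. -/
theorem IsPolynomialKnot.exists_isKnottedArcOf {f g h : ℝ[X]} (hK : IsPolynomialKnot f g h) :
    ∃ (f₁ g₁ m : ℝ[X]) (a : ℝ), (∀ t, 0 < m.eval t) ∧
      IsKnottedArcOf f₁ g₁ ((X - C a) * m ^ 2) a (range (polyCurve f g h)) := by
  obtain ⟨g₁, hK₁, hg₁, hiso₁⟩ := hK.exists_degree_snd_pos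
  obtain ⟨c, D, hD, hD'⟩ := exists_projection_finite_double_points hK₁ hg₁
  have hK₂ := hK₁.add_fst c
  have hiso₂ := hiso₁.trans (ambientIsotopic_add_fst f g₁ h c)
  set f₁ := f + C c * h
  obtain ⟨b, hb⟩ := D.finite_toSet.bddBelow
  -- Adding `M + 1` makes all heights on `D` positive, as the values of `(t - a) m²` to the right of
  -- `a` must be.
  obtain ⟨M, hM⟩ := (D.image fun s => -h.eval s).exists_le
  have hM' : ∀ s ∈ D, 0 < h.eval s + (M + 1) := fun s hs => by
    have := hM _ (Finset.mem_image_of_mem _ hs)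
    linarith
  have ha : ∀ s ∈ D, b - 1 < s := fun s hs => by linarith [hb (Finset.mem_coe.2 hs)]
  set a := b - 1
  obtain ⟨m, hm, hmD, hm1⟩ := exists_positive_eval_eq D
    (fun s => √((h.eval s + (M + 1)) / (s - a)))
    (fun s hs => Real.sqrt_pos.2 (div_pos (hM' s hs) (sub_pos.2 (ha s hs))))
  set h₁ : ℝ[X] := (X - C a) * m ^ 2 with hh₁
  have heval : ∀ t, h₁.eval t = (t - a) * m.eval t ^ 2 := fun t => by simp [hh₁]
  have hder : ∀ t, (derivative h₁).eval t =
      m.eval t ^ 2 + (t - a) * (2 * m.eval t * (derivative m).eval t) := fun t => by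
    simp [hh₁, derivative_mul, derivative_pow]
  have hh₁D : ∀ s ∈ D, h₁.eval s = h.eval s + (M + 1) := fun s hs => by
    have h1 := sub_pos.2 (ha s hs)
    rw [heval, (hmD s hs).1, Real.sq_sqrt (div_pos (hM' s hs) h1).le]
    field_simp
  have hpos : ∀ t, a < t → 0 < h₁.eval t := fun t ht => by
    rw [heval]
    have := hm t
    have := sub_pos.2 ht
    positivity
  have hend : h₁.eval a = 0 := by simp [heval]
  have hknot : IsPolynomialKnot f₁ g₁ h₁ := by
    constructor
    · intro s t hst
      by_contra hne
      rw [polyCurve_eq_iff] at hst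
      obtain ⟨h1, h2, h3⟩ := hst
      rw [hh₁D s (hD s t hne h1 h2), hh₁D t (hD t s (Ne.symm hne) h1.symm h2.symm),
        add_left_inj] at h3
      exact hne (hK₂.injective (polyCurve_eq_iff.2 ⟨h1, h2, h3⟩))
    · intro t ht
      rw [polyCurve_eq_zero_iff] at ht
      obtain ⟨h1, h2, h3⟩ := ht
      -- At a singular parameter of the projection `m' = 0`, which leaves the derivative `m² > 0`.
      rw [hder, (hmD t (hD' t h1 h2)).2, mul_zero, mul_zero, add_zero] at h3
      exact (pow_pos (hm t) 2).ne' h3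
  have hcl : IsClosedMap fun t => (f₁.eval t, g₁.eval t) :=
    isClosedMap_prodMk_eval f₁.continuous hg₁
  refine ⟨f₁, g₁, m, a, hm, ⟨hknot, hend, hpos, ?_, ?_⟩, ?_, ?_⟩
  · rw [hder, sub_self, zero_mul, add_zero]
    exact (pow_pos (hm a) 2).ne'
  · refine tendsto_atTop_mono' _ ?_ (tendsto_atTop_add_const_right atTop (-a) tendsto_id)
    filter_upwards [hm1, eventually_ge_atTop a] with t ht hat
    rw [heval, id, ← sub_eq_add_neg]
    exact le_mul_of_one_le_right (sub_nonneg.2 hat) (one_le_pow₀ ht)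
  · refine AmbientIsotopic.symm (hiso₂.trans ?_)
    refine AmbientIsotopic.range_of_heights f₁.continuous g₁.continuous h.continuous
      h₁.continuous hcl fun s t h1 h2 => ?_
    by_cases hst : s = t
    · rw [hst]
    · rw [hh₁D s (hD s t hst h1 h2), hh₁D t (hD t s (Ne.symm hst) h1.symm h2.symm)]
      ring
  · refine AmbientIsotopic.symm (hiso₂.trans (AmbientIsotopic.trans ?_
      (ambientIsotopic_straighten_lower hend hpos)))
    -- Every crossing parameter exceeds `a`, so the heights on `t ≤ a` are free and may be taken to
    -- be `t - a`.
    refine AmbientIsotopic.range_of_heights f₁.continuous g₁.continuous h.continuous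
      ?_ hcl fun s t h1 h2 => ?_
    · refine Continuous.if_le (by fun_prop) (by fun_prop) continuous_id continuous_const ?_
      rintro t rfl
      rw [hend]
      exact sub_self _
    by_cases hst : s = t
    · rw [hst]
    · have hs := hD s t hst h1 h2
      have ht := hD t s (Ne.symm hst) h1.symm h2.symm
      rw [if_neg (not_le.2 (ha s hs)), if_neg (not_le.2 (ha t ht)), hh₁D s hs, hh₁D t ht]
      ring

/-! ### Chebyshev interpolation and the derivative of its error -/

/-- Rolle's theorem for a finite set of zeros. -/
theorem exists_finset_deriv_eq_zero {F : ℝ → ℝ} (hF : Continuous F) {α β : ℝ} {k : ℕ}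
    {Z : Finset ℝ} (hZ : Z.card = k + 1) (hsub : ∀ z ∈ Z, z ∈ Icc α β) (hzero : ∀ z ∈ Z, F z = 0) :
    ∃ Z' : Finset ℝ, Z'.card = k ∧ (∀ z ∈ Z', z ∈ Icc α β) ∧ ∀ z ∈ Z', deriv F z = 0 := by
  let x := Z.orderEmbOfFin hZ
  have hx : ∀ i, x i ∈ Z := fun i => Z.orderEmbOfFin_mem hZ i
  have hrolle : ∀ i : Fin k, ∃ y ∈ Ioo (x i.castSucc) (x i.succ), deriv F y = 0 := fun i =>
    exists_deriv_eq_zero (x.strictMono i.castSucc_lt_succ) hF.continuousOn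
      (by rw [hzero _ (hx _), hzero _ (hx _)])
  choose y hy hy0 using hrolle
  have hmono : StrictMono y := fun i j hij =>
    calc y i < x i.succ := (hy i).2
      _ ≤ x j.castSucc := x.monotone (Fin.succ_le_castSucc_iff.2 hij)
      _ < y j := (hy j).1
  refine ⟨Finset.univ.map ⟨y, hmono.injective⟩, by simp, ?_, ?_⟩
  · simp only [Finset.mem_map, Finset.mem_univ, true_and, forall_exists_index]
    rintro _ i rfl
    exact ⟨(hsub _ (hx _)).1.trans (hy i).1.le, (hy i).2.le.trans (hsub _ (hx _)).2⟩
  · simp only [Finset.mem_map, Finset.mem_univ, true_and, forall_exists_index]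
    rintro _ i rfl
    exact hy0 i

theorem exists_iteratedDeriv_eq_zero {α β : ℝ} (k : ℕ) {F : ℝ → ℝ} (hF : ContDiff ℝ ∞ F)
    {Z : Finset ℝ} (hZ : Z.card = k + 1) (hsub : ∀ z ∈ Z, z ∈ Icc α β) (hzero : ∀ z ∈ Z, F z = 0) :
    ∃ ξ, iteratedDeriv k F ξ = 0 := by
  induction k generalizing F Z with
  | zero =>
    obtain ⟨z, hz⟩ := Finset.card_pos.1 (by omega : 0 < Z.card)
    exact ⟨z, by simpa using hzero z hz⟩
  | succ k ih =>
    obtain ⟨Z', h1, h2, h3⟩ := exists_finset_deriv_eq_zero hF.continuous hZ hsub hzero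
    rw [iteratedDeriv_succ']
    exact ih ((contDiff_infty_iff_deriv.1 hF).2) h1 h2 h3

theorem Polynomial.contDiff_eval (p : ℝ[X]) {k : WithTop ℕ∞} : ContDiff ℝ k fun x => p.eval x := by
  simp only [← coe_aeval_eq_eval]
  exact p.contDiff_aeval k

theorem Polynomial.iteratedDeriv_eval (p : ℝ[X]) (k : ℕ) :
    iteratedDeriv k (fun x => p.eval x) = fun x => (derivative^[k] p).eval x := by
  induction k with
  | zero => simp
  | succ k ih =>
    rw [iteratedDeriv_succ, ih, Function.iterate_succ_apply']
    funext x
    exact Polynomial.deriv _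

/-- The error estimate for polynomial interpolation. -/
theorem abs_sub_eval_le_of_interpolates {φ : ℝ → ℝ} (hφ : ContDiff ℝ ∞ φ) {n : ℕ}
    (hbound : ∀ x, |iteratedDeriv n φ x| ≤ 1) {p : ℝ[X]} (hp : p.degree < n) {α β : ℝ}
    {Z : Finset ℝ} (hZ : Z.card = n) (hsub : ∀ z ∈ Z, z ∈ Icc α β)
    (hzero : ∀ z ∈ Z, φ z = p.eval z) {s : ℝ} (hs : s ∈ Icc α β) :
    |φ s - p.eval s| ≤ (β - α) ^ n / n.factorial := by
  have hαβ : 0 ≤ β - α := by linarith [hs.1, hs.2]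
  by_cases hsZ : s ∈ Z
  · rw [hzero s hsZ, sub_self, abs_zero]
    positivity
  set w : ℝ[X] := ∏ a ∈ Z, (X - C a) with hw
  have hweval : ∀ x, w.eval x = ∏ a ∈ Z, (x - a) := fun x => by simp [hw, eval_prod]
  have hws : w.eval s ≠ 0 := by
    rw [hweval, Finset.prod_ne_zero_iff]
    intro a ha h
    exact hsZ (by rwa [sub_eq_zero.1 h])
  have hwZ : ∀ z ∈ Z, w.eval z = 0 := fun z hz => by
    rw [hweval]
    exact Finset.prod_eq_zero hz (sub_self z)
  -- This `c` makes `φ - (p + c w)` vanish at `s` as well as on `Z`. Iterated Rolle then gives a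
  -- point where the `n`-th derivative of `φ` is `c n!`.
  set c := (φ s - p.eval s) / w.eval s with hc
  set q : ℝ[X] := p + C c * w with hq
  have hder : derivative^[n] q = C (c * n.factorial) := by
    rw [hq, iterate_map_add, iterate_derivative_eq_zero_of_degree_lt hp, zero_add,
      iterate_derivative_C_mul, hw, iterate_derivative_prod_X_sub_C hZ.ge, hZ]
    simp
  obtain ⟨ξ, hξ⟩ := exists_iteratedDeriv_eq_zero (α := α) (β := β) n
    (F := fun x => φ x - q.eval x) (hφ.sub q.contDiff_eval) (Z := insert s Z)
    (by rw [Finset.card_insert_of_notMem hsZ, hZ])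
    (by
      intro z hz
      rcases Finset.mem_insert.1 hz with rfl | hz
      exacts [hs, hsub z hz])
    (by
      intro z hz
      rcases Finset.mem_insert.1 hz with rfl | hz
      · simp only [hq, hc, eval_add, eval_mul, eval_C]
        field_simp
        ring
      · simp [hq, hwZ z hz, hzero z hz])
  have h1 : iteratedDeriv n φ ξ = c * n.factorial := by
    have h2 := iteratedDeriv_sub (n := n) (x := ξ) (f := φ) (g := fun x => q.eval x)
      (hφ.contDiffAt.of_le (by exact_mod_cast le_top)) q.contDiff_eval.contDiffAt
    have h3 : iteratedDeriv n (φ - fun x => q.eval x) ξ = 0 := hξ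
    rw [h3, iteratedDeriv_eval, hder] at h2
    simp only [eval_C] at h2
    linarith
  have h2 : |c| * n.factorial ≤ 1 := by
    have := hbound ξ
    rwa [h1, abs_mul, Nat.abs_cast] at this
  have h3 : |w.eval s| ≤ (β - α) ^ n := by
    rw [hweval, Finset.abs_prod, ← hZ, ← Finset.prod_const]
    refine Finset.prod_le_prod (fun _ _ => abs_nonneg _) fun z hz => ?_
    have := hsub z hz
    rw [abs_le]
    constructor <;> linarith [this.1, this.2, hs.1, hs.2]
  have h4 : φ s - p.eval s = c * w.eval s := by
    rw [hc]
    field_simp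
  have h5 : (0 : ℝ) < n.factorial := by positivity
  rw [h4, abs_mul, le_div_iff₀ h5]
  calc |c| * |w.eval s| * n.factorial = (|c| * n.factorial) * |w.eval s| := by ring
    _ ≤ 1 * |w.eval s| := by gcongr
    _ ≤ (β - α) ^ n := by rwa [one_mul]

theorem chebyshevPoint_mem_Icc {α β : ℝ} (h : α ≤ β) (n j : ℕ) :
    chebyshevPoint α β n j ∈ Icc α β := by
  have h1 := Chebyshev.node_mem_Icc (n := n) (i := j)
  constructor <;> unfold chebyshevPoint <;> nlinarith [h1.1, h1.2]

theorem chebyshevPoint_injOn {α β : ℝ} (h : α < β) (n : ℕ) :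
    Set.InjOn (chebyshevPoint α β n) (Finset.range (n + 1)) := by
  intro i hi j hj hij
  refine (Chebyshev.strictAntiOn_node n).injOn hi hj ?_
  unfold chebyshevPoint at hij
  have h2 : (β - α) / 2 ≠ 0 := by linarith [sub_pos.2 h] |> fun h : 0 < (β - α) / 2 => h.ne'
  exact mul_left_cancel₀ h2 (by linarith)

theorem eval_chebyshevApprox (u : ℝ → ℝ) {α β : ℝ} (h : α < β) {n j : ℕ} (hj : j ≤ n) :
    (chebyshevApprox u α β n).eval (chebyshevPoint α β n j) = u (chebyshevPoint α β n j) :=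
  Lagrange.eval_interpolate_at_node (v := chebyshevPoint α β n)
    (fun j => u (chebyshevPoint α β n j)) (chebyshevPoint_injOn h n) (by simpa using by omega)

/-- Exactness at both ends of the interval is what closes up the approximate circle. -/
theorem eval_chebyshevApprox_left (u : ℝ → ℝ) {α β : ℝ} (h : α < β) (n : ℕ) :
    (chebyshevApprox u α β n).eval α = u α := by
  have h1 : chebyshevPoint α β n 0 = α := by
    rw [chebyshevPoint, Chebyshev.node_eq_one]; ring
  simpa [h1] using eval_chebyshevApprox u h (Nat.zero_le n)

theorem eval_chebyshevApprox_right (u : ℝ → ℝ) {α β : ℝ} (h : α < β) {n : ℕ} (hn : n ≠ 0) :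
    (chebyshevApprox u α β n).eval β = u β := by
  have h1 : chebyshevPoint α β n n = β := by
    rw [chebyshevPoint, Chebyshev.node_eq_neg_one hn]; ring
  simpa [h1] using eval_chebyshevApprox u h (le_refl n)

/-- The derivative of a Chebyshev approximation of a function with derivatives bounded by `1`. -/
theorem abs_deriv_sub_chebyshevApprox_le {u : ℝ → ℝ} (hu : ContDiff ℝ ∞ u) {n : ℕ}
    (hbound : ∀ x, |iteratedDeriv (n + 1) u x| ≤ 1) {α β : ℝ} (h : α < β) {s : ℝ}
    (hs : s ∈ Icc α β) :
    |deriv u s - (derivative (chebyshevApprox u α β n)).eval s| ≤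
      (β - α) ^ n / n.factorial := by
  set p := chebyshevApprox u α β n with hp
  have hinj := chebyshevPoint_injOn h n
  -- The error has `n + 1` zeros, hence its derivative has `n`: the derivative of the approximation
  -- has degree below `n` and interpolates `deriv u` there.
  obtain ⟨Z, hZ, hsub, hzero⟩ := exists_finset_deriv_eq_zero (F := fun x => u x - p.eval x)
    (α := α) (β := β) (k := n) (Z := (Finset.range (n + 1)).image (chebyshevPoint α β n))
    (hu.continuous.sub p.continuous)
    (by rw [Finset.card_image_of_injOn hinj, Finset.card_range])
    (by
      intro z hz
      obtain ⟨j, -, rfl⟩ := Finset.mem_image.1 hz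
      exact chebyshevPoint_mem_Icc h.le n j)
    (by
      intro z hz
      obtain ⟨j, hj, rfl⟩ := Finset.mem_image.1 hz
      rw [hp, eval_chebyshevApprox u h (by simpa [Nat.lt_succ_iff] using hj), sub_self])
  refine abs_sub_eval_le_of_interpolates (contDiff_infty_iff_deriv.1 hu).2
    (fun x => by rw [← iteratedDeriv_succ']; exact hbound x) ?_ hZ hsub ?_ hs
  · by_cases hp0 : p = 0
    · rw [hp0, derivative_zero, degree_zero]
      exact WithBot.bot_lt_coe n
    refine (degree_derivative_lt hp0).trans_le ?_
    have h1 := Lagrange.degree_interpolate_lt (fun j => u (chebyshevPoint α β n j)) hinj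
    rw [Finset.card_range] at h1
    change p.degree < _ at h1
    rw [degree_eq_natDegree hp0] at h1 ⊢
    exact_mod_cast Nat.lt_succ_iff.1 (by exact_mod_cast h1)
  · intro z hz
    have h1 := hzero z hz
    rw [deriv_fun_sub (hu.differentiable (by simp) z) p.differentiable.differentiableAt,
      Polynomial.deriv] at h1
    linarith

/-- For large degrees the error of the Chebyshev approximation has a small Lipschitz constant. -/
theorem eventually_lipschitz_chebyshevApprox_sub {u : ℝ → ℝ} (hu : ContDiff ℝ ∞ u)
    (hbound : ∀ n x, |iteratedDeriv n u x| ≤ 1) {α β : ℝ} (h : α < β) {ε : ℝ} (hε : 0 < ε) :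
    ∀ᶠ n in atTop, ∀ s ∈ Icc α β, ∀ t ∈ Icc α β,
      |((chebyshevApprox u α β n).eval s - u s) - ((chebyshevApprox u α β n).eval t - u t)| ≤
        ε * |s - t| := by
  have hlim := FloorSemiring.tendsto_pow_div_factorial_atTop (β - α)
  filter_upwards [hlim.eventually (gt_mem_nhds hε)] with n hn s hs t ht
  set p := chebyshevApprox u α β n with hp
  have hder : ∀ x ∈ Icc α β, HasDerivWithinAt (fun x => p.eval x - u x)
      ((derivative p).eval x - deriv u x) (Icc α β) x := fun x _ =>
    ((p.hasDerivAt x).sub (hu.differentiable (by simp) x).hasDerivAt).hasDerivWithinAt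
  refine (convex_Icc α β).norm_image_sub_le_of_norm_hasDerivWithin_le hder (fun x hx => ?_) ht hs
  rw [Real.norm_eq_abs, abs_sub_comm]
  exact (abs_deriv_sub_chebyshevApprox_le hu (hbound _) h hx).trans hn.le

/-! ### From a nearly circular closed curve to a small displacement of space -/

open Complex in
theorem Complex.exists_angle (w : ℂ) :
    ∃ θ ∈ Icc (0 : ℝ) (2 * Real.pi), w = ‖w‖ * exp (θ * Complex.I) := by
  by_cases h : 0 ≤ arg w
  · exact ⟨arg w, ⟨h, by linarith [arg_le_pi w, Real.pi_pos]⟩, (norm_mul_exp_arg_mul_I w).symm⟩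
  · refine ⟨arg w + 2 * Real.pi, ⟨by linarith [neg_pi_lt_arg w, Real.pi_pos], by linarith⟩, ?_⟩
    push_cast
    rw [add_mul, exp_add, exp_two_pi_mul_I, mul_one, norm_mul_exp_arg_mul_I]

-- The chord is `2 |sin ((s - t) / 2)|`, and Jordan's inequality bounds it below.
open Complex in
theorem Complex.two_div_pi_mul_le_norm_exp_sub_exp {s t : ℝ} (hst : |s - t| ≤ Real.pi) :
    2 / Real.pi * |s - t| ≤ ‖exp (s * Complex.I) - exp (t * Complex.I)‖ := by
  have h1 : exp (s * Complex.I) - exp (t * Complex.I) = exp (t * Complex.I) * (exp (Complex.I * (s - t : ℝ)) - 1) := by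
    rw [mul_sub, ← exp_add, mul_one]
    congr 2
    push_cast
    ring
  rw [h1, norm_mul, norm_exp_ofReal_mul_I, one_mul, norm_exp_I_mul_ofReal_sub_one, norm_mul,
    Real.norm_ofNat, Real.norm_eq_abs]
  have key : ∀ x : ℝ, |x| ≤ Real.pi → 2 / Real.pi * |x| ≤ 2 * |Real.sin (x / 2)| := by
    intro x hx
    have h2 := Real.mul_le_sin (x := |x| / 2) (by positivity) (by linarith)
    have h3 : Real.sin (|x| / 2) ≤ |Real.sin (x / 2)| := by
      rcases abs_cases x with ⟨h, -⟩ | ⟨h, -⟩ <;> rw [h]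
      · exact le_abs_self _
      · rw [neg_div, Real.sin_neg]
        exact neg_le_abs _
    linarith
  exact key _ hst

open Complex in
/-- A function on the circle with small Lipschitz constant, given in terms of the angle, extends
radially to a function on the plane with small Lipschitz constant. -/
theorem exists_radial_extension {ζ : ℝ → ℂ} {ε : ℝ} (hε : 0 ≤ ε)
    (hζ : ∀ s ∈ Icc (0 : ℝ) (2 * Real.pi), ∀ t ∈ Icc (0 : ℝ) (2 * Real.pi),
      ‖ζ s - ζ t‖ ≤ ε * |s - t|)
    (h0 : ζ 0 = 0) (h1 : ζ (2 * Real.pi) = 0) :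
    ∃ e : ℂ → ℂ, (∀ v w, ‖e v - e w‖ ≤ 12 * ε * ‖v - w‖) ∧
      ∀ r : ℝ, 0 ≤ r → ∀ s ∈ Icc (0 : ℝ) (2 * Real.pi), e (r * exp (s * Complex.I)) = r * ζ s := by
  have hpi := Real.pi_pos
  have hpi4 := Real.pi_le_four
  have hz : (0 : ℝ) ∈ Icc 0 (2 * Real.pi) := ⟨le_rfl, by positivity⟩
  have ht : 2 * Real.pi ∈ Icc 0 (2 * Real.pi) := ⟨by positivity, le_rfl⟩
  have hchord' : ∀ s ∈ Icc (0 : ℝ) (2 * Real.pi), ∀ t ∈ Icc (0 : ℝ) (2 * Real.pi), t ≤ s →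
      ‖ζ s - ζ t‖ ≤ 2 * ε * ‖exp (s * Complex.I) - exp (t * Complex.I)‖ := by
    have hmul : ∀ x y : ℝ, 2 / Real.pi * x ≤ y → 0 ≤ x → ε * x ≤ 2 * ε * y := by
      intro x y hxy hx
      have h2 : 1 / 2 * x ≤ 2 / Real.pi * x := by
        gcongr ?_ * x
        rw [div_le_div_iff₀ (by norm_num) hpi]
        linarith
      nlinarith
    intro s hs t ht' hts
    rcases le_total (s - t) Real.pi with hle | hle
    · refine (hζ s hs t ht').trans (hmul _ _ (two_div_pi_mul_le_norm_exp_sub_exp ?_)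
        (abs_nonneg _))
      rwa [abs_of_nonneg (sub_nonneg.2 hts)]
    -- For angles more than `π` apart the shorter arc passes through angle `0`, where `ζ` vanishes;
    -- the estimate is split there.
    · have h2 : |s - 2 * Real.pi - t| = 2 * Real.pi - s + t := by
        rw [abs_of_nonpos (by linarith [hs.2, ht'.1])]
        ring
      have h3 : exp (((s - 2 * Real.pi : ℝ) : ℂ) * Complex.I) = exp (s * Complex.I) := by
        push_cast
        rw [sub_mul, exp_sub, exp_two_pi_mul_I, div_one]
      have h4 := two_div_pi_mul_le_norm_exp_sub_exp (s := s - 2 * Real.pi) (t := t)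
        (by rw [h2]; linarith)
      rw [h2, h3] at h4
      refine le_trans ?_ (hmul _ _ h4 (by linarith [hs.2, ht'.1]))
      have h5 := hζ s hs _ ht
      have h6 := hζ t ht' _ hz
      rw [h1, sub_zero, abs_of_nonpos (by linarith [hs.2])] at h5
      rw [h0, sub_zero, sub_zero, abs_of_nonneg ht'.1] at h6
      calc ‖ζ s - ζ t‖ ≤ ‖ζ s‖ + ‖ζ t‖ := norm_sub_le _ _
        _ ≤ ε * -(s - 2 * Real.pi) + ε * t := add_le_add h5 h6
        _ = _ := by ring
  have hchord : ∀ s ∈ Icc (0 : ℝ) (2 * Real.pi), ∀ t ∈ Icc (0 : ℝ) (2 * Real.pi),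
      ‖ζ s - ζ t‖ ≤ 2 * ε * ‖exp (s * Complex.I) - exp (t * Complex.I)‖ := by
    intro s hs t ht'
    rcases le_total t s with h | h
    · exact hchord' s hs t ht' h
    · rw [norm_sub_rev, norm_sub_rev (exp _)]
      exact hchord' t ht' s hs h
  have hmain : ∀ r : ℝ, 0 ≤ r → ∀ r' : ℝ, 0 ≤ r' → ∀ s ∈ Icc (0 : ℝ) (2 * Real.pi),
      ∀ s' ∈ Icc (0 : ℝ) (2 * Real.pi), ‖r * ζ s - r' * ζ s'‖ ≤
        12 * ε * ‖r * exp (s * Complex.I) - r' * exp (s' * Complex.I)‖ := by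
    intro r hr r' hr' s hs s' hs'
    set N := ‖(r : ℂ) * exp (s * Complex.I) - r' * exp (s' * Complex.I)‖ with hN
    have hnorm : ∀ x : ℝ, 0 ≤ x → ∀ y : ℝ, ‖(x : ℂ) * exp (y * Complex.I)‖ = x := fun x hx y => by
      rw [norm_mul, norm_exp_ofReal_mul_I, mul_one, norm_real, Real.norm_of_nonneg hx]
    have h2 : |r - r'| ≤ N := by
      have := abs_norm_sub_norm_le ((r : ℂ) * exp (s * Complex.I)) (r' * exp (s' * Complex.I))
      rwa [hnorm r hr, hnorm r' hr'] at this
    have h3 : r * ‖exp (s * Complex.I) - exp (s' * Complex.I)‖ ≤ 2 * N := by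
      have h4 : (r : ℂ) * (exp (s * Complex.I) - exp (s' * Complex.I)) =
          (r * exp (s * Complex.I) - r' * exp (s' * Complex.I)) - ((r - r' : ℝ) : ℂ) * exp (s' * Complex.I) := by
        push_cast
        ring
      have h5 : r * ‖exp (s * Complex.I) - exp (s' * Complex.I)‖ = ‖(r : ℂ) * (exp (s * Complex.I) - exp (s' * Complex.I))‖ := by
        rw [norm_mul, norm_real, Real.norm_of_nonneg hr]
      rw [h5, h4]
      refine (norm_sub_le _ _).trans ?_
      rw [norm_mul, norm_exp_ofReal_mul_I, mul_one, norm_real, Real.norm_eq_abs]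
      linarith
    have h6 : ‖ζ s'‖ ≤ 8 * ε := by
      have := hζ s' hs' 0 hz
      rw [h0, sub_zero, sub_zero, abs_of_nonneg hs'.1] at this
      nlinarith [hs'.2]
    have h7 : (r : ℂ) * ζ s - r' * ζ s' = r * (ζ s - ζ s') + ((r - r' : ℝ) : ℂ) * ζ s' := by
      push_cast
      ring
    rw [h7]
    -- The constant is `12 = 2 · 2 + 8`: the angular part costs `2ε` times a chord bounded by `2N`,
    -- the radial part `8ε` because `2π ≤ 8`.
    calc ‖(r : ℂ) * (ζ s - ζ s') + ((r - r' : ℝ) : ℂ) * ζ s'‖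
        ≤ r * ‖ζ s - ζ s'‖ + |r - r'| * ‖ζ s'‖ := by
          refine (norm_add_le _ _).trans ?_
          rw [norm_mul, norm_mul, norm_real, norm_real, Real.norm_of_nonneg hr, Real.norm_eq_abs]
      _ ≤ r * (2 * ε * ‖exp (s * Complex.I) - exp (s' * Complex.I)‖) + N * (8 * ε) := by
          gcongr
          exact hchord s hs s' hs'
      _ = 2 * ε * (r * ‖exp (s * Complex.I) - exp (s' * Complex.I)‖) + N * (8 * ε) := by ring
      _ ≤ 2 * ε * (2 * N) + N * (8 * ε) := by gcongr
      _ = 12 * ε * N := by ring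
  choose θ hθ hw using Complex.exists_angle
  refine ⟨fun w => ‖w‖ * ζ (θ w), fun v w => ?_, fun r hr s hs => ?_⟩
  · have := hmain ‖v‖ (norm_nonneg v) ‖w‖ (norm_nonneg w) (θ v) (hθ v) (θ w) (hθ w)
    rwa [← hw v, ← hw w] at this
  · set w := (r : ℂ) * exp (s * Complex.I) with hrw
    -- The Lipschitz estimate for two polar forms of the same point shows that the chosen angle does
    -- not matter.
    have := hmain ‖w‖ (norm_nonneg w) r hr (θ w) (hθ w) s hs
    rw [← hw w, ← hrw, sub_self, norm_zero, mul_zero] at this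
    exact sub_eq_zero.1 (norm_le_zero_iff.1 this)

/-- If the closed curve `(S, C)` is close to the circle, a small displacement of `ℝ⁴` carries
the circles about the plane `{(x, y, 0, 0)}` to multiples of this curve. -/
theorem exists_displacement_of_circle {S C : ℝ → ℝ} {ε : ℝ} (hε : 0 ≤ ε) (hε' : ε ≤ 1 / 48)
    (hS : ∀ s ∈ Icc (0 : ℝ) (2 * Real.pi), ∀ t ∈ Icc (0 : ℝ) (2 * Real.pi),
      |(S s - Real.sin s) - (S t - Real.sin t)| ≤ ε * |s - t|)
    (hC : ∀ s ∈ Icc (0 : ℝ) (2 * Real.pi), ∀ t ∈ Icc (0 : ℝ) (2 * Real.pi),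
      |(C s - Real.cos s) - (C t - Real.cos t)| ≤ ε * |s - t|)
    (hS0 : S 0 = 0) (hS1 : S (2 * Real.pi) = 0) (hC0 : C 0 = 1) (hC1 : C (2 * Real.pi) = 1) :
    ∃ e : EuclideanSpace ℝ (Fin 4) → EuclideanSpace ℝ (Fin 4), LipschitzWith (1 / 2) e ∧
      ∀ x y r : ℝ, 0 ≤ r → ∀ s ∈ Icc (0 : ℝ) (2 * Real.pi),
        !₂[x, y, r * Real.sin s, r * Real.cos s] +
          e !₂[x, y, r * Real.sin s, r * Real.cos s] = !₂[x, y, r * S s, r * C s] := by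
  -- The two coordinate errors add up to `2ε`, and `12 · 2ε ≤ 1/2` by the bound `1/48`. The complex
  -- coordinate is `q 3 + i q 2`, since the cosine stands last.
  obtain ⟨e, he, hes⟩ := exists_radial_extension
    (ζ := fun s => (⟨C s - Real.cos s, S s - Real.sin s⟩ : ℂ)) (ε := 2 * ε) (by positivity)
    (by
      intro s hs t ht
      refine (Complex.norm_le_abs_re_add_abs_im _).trans ?_
      simp only [Complex.sub_re, Complex.sub_im]
      linarith [hS s hs t ht, hC s hs t ht])
    (by apply Complex.ext <;> simp [hS0, hC0]) (by apply Complex.ext <;> simp [hS1, hC1])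
  refine ⟨fun q => !₂[0, 0, (e ⟨q 3, q 2⟩).im, (e ⟨q 3, q 2⟩).re], ?_, ?_⟩
  · refine LipschitzWith.of_dist_le_mul fun q q' => ?_
    have h1 := he ⟨q 3, q 2⟩ ⟨q' 3, q' 2⟩
    have h2 : 12 * (2 * ε) ≤ 1 / 2 := by linarith
    have h3 : ‖(⟨q 3, q 2⟩ : ℂ) - ⟨q' 3, q' 2⟩‖ ≤ ‖q - q'‖ := by
      rw [EuclideanSpace.norm_eq, Complex.norm_def]
      apply Real.sqrt_le_sqrt
      simp only [Complex.normSq_apply, Complex.sub_re, Complex.sub_im, Fin.sum_univ_four,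
        Real.norm_eq_abs, sq_abs, PiLp.sub_apply]
      nlinarith [sq_nonneg (q 0 - q' 0), sq_nonneg (q 1 - q' 1)]
    rw [dist_eq_norm, dist_eq_norm]
    have h4 : ∀ v w : ℂ, ‖(!₂[0, 0, v.im, v.re] : EuclideanSpace ℝ (Fin 4)) -
        !₂[0, 0, w.im, w.re]‖ = ‖v - w‖ := by
      intro v w
      rw [EuclideanSpace.norm_eq, Complex.norm_def]
      congr 1
      simp [Complex.normSq_apply, Fin.sum_univ_four]
      ring
    rw [h4]
    calc _ ≤ 12 * (2 * ε) * ‖(⟨q 3, q 2⟩ : ℂ) - ⟨q' 3, q' 2⟩‖ := h1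
      _ ≤ 1 / 2 * ‖q - q'‖ := by gcongr
      _ = _ := by norm_num
  · intro x y r hr s hs
    have h1 : (⟨r * Real.cos s, r * Real.sin s⟩ : ℂ) = r * Complex.exp (s * Complex.I) := by
      apply Complex.ext <;> simp [Complex.exp_ofReal_mul_I_re, Complex.exp_ofReal_mul_I_im]
    have h2 := hes r hr s hs
    rw [← h1] at h2
    ext i
    fin_cases i <;> simp [h2] <;> ring

theorem exists_eq_mul_sin_and_eq_mul_cos {c d r : ℝ} (hr : 0 ≤ r) (h : c ^ 2 + d ^ 2 = r ^ 2) :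
    ∃ s ∈ Icc (0 : ℝ) (2 * Real.pi), c = r * Real.sin s ∧ d = r * Real.cos s := by
  obtain ⟨s, hs, hw⟩ := Complex.exists_angle ⟨d, c⟩
  have hn : ‖(⟨d, c⟩ : ℂ)‖ = r := by
    rw [Complex.norm_def, Complex.normSq_mk, ← Real.sqrt_sq hr, ← h]
    congr 1
    ring
  rw [hn] at hw
  refine ⟨s, hs, ?_, ?_⟩
  · simpa [Complex.exp_ofReal_mul_I_im] using congrArg Complex.im hw
  · simpa [Complex.exp_ofReal_mul_I_re] using congrArg Complex.re hw

/-! ### The spun arc and its approximate parametrization -/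

/-- The spin of a subset of the upper half space in terms of the distance to the axis. -/
theorem mem_spin_iff {k : Set (EuclideanSpace ℝ (Fin 3))} (hk : ∀ p ∈ k, 0 ≤ p 2)
    {q : EuclideanSpace ℝ (Fin 4)} :
    q ∈ spin k ↔ ∃ p ∈ k, q 0 = p 0 ∧ q 1 = p 1 ∧ q 2 ^ 2 + q 3 ^ 2 = p 2 ^ 2 := by
  constructor
  · rintro ⟨p, hp, θ, -, rfl⟩
    refine ⟨p, hp, rfl, rfl, ?_⟩
    have := Real.sin_sq_add_cos_sq θ
    simp only [Matrix.cons_val]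
    linear_combination p 2 ^ 2 * this
  · rintro ⟨p, hp, h0, h1, h2⟩
    obtain ⟨s, hs, h3, h4⟩ := exists_eq_mul_sin_and_eq_mul_cos (c := q 3) (d := q 2) (hk p hp)
      (by rw [add_comm, h2])
    refine ⟨p, hp, s, hs, ?_⟩
    ext i
    fin_cases i <;> simp [h0, h1, h3, h4]

theorem IsHalfSpaceArc.nonneg {f g h : ℝ[X]} {a : ℝ} (hk : IsHalfSpaceArc f g h a) {t : ℝ}
    (ht : a ≤ t) : 0 ≤ h.eval t := by
  rcases ht.eq_or_lt with rfl | ht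
  exacts [hk.endpoint.ge, (hk.positive t ht).le]

/-- Sine and cosine occur here in the opposite order to `spin`; both orders sweep out the full
circle, so the sets agree. -/
theorem IsHalfSpaceArc.spin_eq {f g h : ℝ[X]} {a : ℝ} (hk : IsHalfSpaceArc f g h a) :
    spin (polyArc f g h a) = (fun x : ℝ × ℝ => (!₂[f.eval x.1, g.eval x.1,
      h.eval x.1 * Real.sin x.2, h.eval x.1 * Real.cos x.2] : EuclideanSpace ℝ (Fin 4))) ''
        (Ici a ×ˢ Icc (0 : ℝ) (2 * Real.pi)) := by
  ext q
  rw [mem_spin_iff (by rintro _ ⟨t, ht, rfl⟩; exact hk.nonneg ht)]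
  constructor
  · rintro ⟨_, ⟨t, ht, rfl⟩, h0, h1, h2⟩
    obtain ⟨s, hs, h3, h4⟩ := exists_eq_mul_sin_and_eq_mul_cos (hk.nonneg ht) h2
    refine ⟨(t, s), ⟨ht, hs⟩, ?_⟩
    ext i
    fin_cases i
    exacts [h0.symm, h1.symm, h3.symm, h4.symm]
  · rintro ⟨⟨t, s⟩, ⟨ht, hs⟩, rfl⟩
    refine ⟨_, ⟨t, ht, rfl⟩, rfl, rfl, ?_⟩
    have := Real.sin_sq_add_cos_sq s
    simp only [Matrix.cons_val, polyCurve]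
    linear_combination h.eval t ^ 2 * this

theorem Real.eq_or_endpoints_of_sin_eq_of_cos_eq {s t : ℝ} (hs : s ∈ Icc (0 : ℝ) (2 * Real.pi))
    (ht : t ∈ Icc (0 : ℝ) (2 * Real.pi)) (h1 : Real.sin s = Real.sin t)
    (h2 : Real.cos s = Real.cos t) :
    s = t ∨ (s = 0 ∧ t = 2 * Real.pi) ∨ (s = 2 * Real.pi ∧ t = 0) := by
  obtain ⟨n, hn⟩ := Real.Angle.angle_eq_iff_two_pi_dvd_sub.1
    (Real.Angle.cos_sin_inj h2 h1)
  have hpi := Real.pi_pos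
  have hn1 : (n : ℝ) ≤ 1 := by
    by_contra! h
    nlinarith [hs.2, ht.1]
  have hn2 : (-1 : ℝ) ≤ n := by
    by_contra! h
    nlinarith [hs.1, ht.2]
  have hn1' : n ≤ 1 := by exact_mod_cast hn1
  have hn2' : -1 ≤ n := by exact_mod_cast hn2
  interval_cases n
  · right; left
    push_cast at hn
    constructor <;> linarith [hs.1, ht.2]
  · left
    push_cast at hn
    linarith
  · right; right
    push_cast at hn
    constructor <;> linarith [hs.2, ht.1]

/-- The surface parametrized with Chebyshev approximations of sine and cosine is the spun arc up to
a small ambient isotopy. -/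
theorem IsHalfSpaceArc.spinParam_chebyshevApprox {f g h : ℝ[X]} {a : ℝ}
    (hk : IsHalfSpaceArc f g h a) {ε : ℝ} (hε : 0 < ε) : ∃ N : ℕ, ∀ n : ℕ, N ≤ n → ∀ S C : ℝ[X],
      S = chebyshevApprox Real.sin 0 (2 * Real.pi) n →
      C = chebyshevApprox Real.cos 0 (2 * Real.pi) n →
      (∀ s ∈ Icc (0 : ℝ) (2 * Real.pi),
        |S.eval s - Real.sin s| < ε ∧ |C.eval s - Real.cos s| < ε) ∧
      (∀ t ∈ Ici a, ∀ t' ∈ Ici a, ∀ s ∈ Icc (0 : ℝ) (2 * Real.pi),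
        ∀ s' ∈ Icc (0 : ℝ) (2 * Real.pi),
        (spinParam f g h S C (t, s) = spinParam f g h S C (t', s') ↔
          t = t' ∧ (t = a ∨ s = s' ∨ (s = 0 ∧ s' = 2 * Real.pi) ∨
            (s = 2 * Real.pi ∧ s' = 0)))) ∧
      AmbientIsotopic (spinParam f g h S C '' (Ici a ×ˢ Icc (0 : ℝ) (2 * Real.pi)))
        (spin (polyArc f g h a)) := by
  have hpi : (0 : ℝ) < 2 * Real.pi := by positivity
  -- The error starts at `0`, so `ε / 8` gives the uniform bound because `2π < 8`; `1 / 48` gives a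
  -- contraction.
  set δ := min (ε / 8) (1 / 48) with hδ
  have hδ0 : 0 < δ := lt_min (by positivity) (by norm_num)
  have hδ1 : δ ≤ 1 / 48 := min_le_right _ _
  have hδ2 : δ * (2 * Real.pi) < ε := by
    have h1 : δ ≤ ε / 8 := min_le_left _ _
    nlinarith [Real.pi_lt_four]
  obtain ⟨N, hN⟩ := eventually_atTop.1 ((eventually_lipschitz_chebyshevApprox_sub
    Real.contDiff_sin Real.abs_iteratedDeriv_sin_le_one hpi hδ0).and
    (eventually_lipschitz_chebyshevApprox_sub
      Real.contDiff_cos Real.abs_iteratedDeriv_cos_le_one hpi hδ0))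
  -- The shift forces `n ≠ 0`; for `n = 0` the right endpoint is not a node.
  refine ⟨N + 1, fun n hn S C hS hC => ?_⟩
  obtain ⟨hSl, hCl⟩ := hN n (by omega)
  rw [← hS] at hSl
  rw [← hC] at hCl
  have hn0 : n ≠ 0 := by omega
  have hS0 : S.eval 0 = 0 := by
    rw [hS, eval_chebyshevApprox_left _ hpi, Real.sin_zero]
  have hC0 : C.eval 0 = 1 := by
    rw [hC, eval_chebyshevApprox_left _ hpi, Real.cos_zero]
  have hS1 : S.eval (2 * Real.pi) = 0 := by
    rw [hS, eval_chebyshevApprox_right _ hpi hn0, Real.sin_two_pi]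
  have hC1 : C.eval (2 * Real.pi) = 1 := by
    rw [hC, eval_chebyshevApprox_right _ hpi hn0, Real.cos_two_pi]
  obtain ⟨e, he, hes⟩ := exists_displacement_of_circle hδ0.le hδ1 hSl hCl hS0 hS1 hC0 hC1
  have hinj : Function.Injective fun x => x + e x := by
    intro x y hxy
    have h1 := he.norm_sub_le x y
    have h2 : x - y = e y - e x := by
      have : x + e x = y + e y := hxy
      rw [sub_eq_sub_iff_add_eq_add, this, add_comm]
    rw [norm_sub_rev, ← h2] at h1
    have h3 : ((1 / 2 : NNReal) : ℝ) = 1 / 2 := by norm_num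
    rw [h3] at h1
    exact sub_eq_zero.1 (norm_le_zero_iff.1 (by linarith))
  have hparam : ∀ t ∈ Ici a, ∀ s ∈ Icc (0 : ℝ) (2 * Real.pi), spinParam f g h S C (t, s) =
      (fun x => x + e x) !₂[f.eval t, g.eval t, h.eval t * Real.sin s, h.eval t * Real.cos s] :=
    fun t ht s hs => (hes _ _ _ (hk.nonneg ht) s hs).symm
  have hz : (0 : ℝ) ∈ Icc 0 (2 * Real.pi) := ⟨le_rfl, hpi.le⟩
  refine ⟨fun s hs => ?_, fun t ht t' ht' s hs s' hs' => ⟨fun heq => ?_, ?_⟩, ?_⟩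
  · have h1 := hSl s hs 0 hz
    have h2 := hCl s hs 0 hz
    rw [hS0, Real.sin_zero, sub_zero, sub_zero, sub_zero, abs_of_nonneg hs.1] at h1
    rw [hC0, Real.cos_zero, sub_self, sub_zero, sub_zero, abs_of_nonneg hs.1] at h2
    have h3 : δ * s ≤ δ * (2 * Real.pi) := by gcongr; exact hs.2
    constructor <;> linarith
  · rw [hparam t ht s hs, hparam t' ht' s' hs'] at heq
    have heq := hinj heq
    have h0 : f.eval t = f.eval t' := congrArg (fun x => x 0) heq
    have h1 : g.eval t = g.eval t' := congrArg (fun x => x 1) heq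
    have h2 : h.eval t * Real.sin s = h.eval t' * Real.sin s' := congrArg (fun x => x 2) heq
    have h3 : h.eval t * Real.cos s = h.eval t' * Real.cos s' := congrArg (fun x => x 3) heq
    have h4 : h.eval t = h.eval t' := by
      rw [← sq_eq_sq₀ (hk.nonneg ht) (hk.nonneg ht')]
      have e1 := Real.sin_sq_add_cos_sq s
      have e2 := Real.sin_sq_add_cos_sq s'
      linear_combination (h.eval t * Real.sin s + h.eval t' * Real.sin s') * h2 +
        (h.eval t * Real.cos s + h.eval t' * Real.cos s') * h3 - h.eval t ^ 2 * e1 +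
        h.eval t' ^ 2 * e2
    have h5 : t = t' := hk.knot.injective (polyCurve_eq_iff.2 ⟨h0, h1, h4⟩)
    subst h5
    refine ⟨rfl, ?_⟩
    rcases (mem_Ici.1 ht).eq_or_lt with h6 | h6
    · exact Or.inl h6.symm
    · right
      have h7 := (hk.positive t h6).ne'
      exact Real.eq_or_endpoints_of_sin_eq_of_cos_eq hs hs' (mul_left_cancel₀ h7 h2)
        (mul_left_cancel₀ h7 h3)
  · rintro ⟨rfl, rfl | rfl | ⟨rfl, rfl⟩ | ⟨rfl, rfl⟩⟩
    · simp [spinParam, hk.endpoint]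
    · rfl
    · simp [spinParam, hS0, hS1, hC0, hC1]
    · simp [spinParam, hS0, hS1, hC0, hC1]
  · apply AmbientIsotopic.symm
    refine AmbientIsotopic.of_contraction e (K := 1 / 2) (by norm_num) he ?_
    rw [hk.spin_eq, image_image]
    refine image_congr ?_
    rintro ⟨t, s⟩ ⟨ht, hs⟩
    exact (hparam t ht s hs).symm

/-! ### Surfaces of revolution -/

/-- The surface of revolution in `ℝ⁴` about the plane `{(0, 0, z, w)}` with profile
`τ ↦ (√τ μ(τ), F(τ), G(τ))`, where `τ` is the square of the distance to the origin of the source. -/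
noncomputable def revolutionSurface (F G μ : ℝ → ℝ) (x : EuclideanSpace ℝ (Fin 2)) : EuclideanSpace ℝ (Fin 4) :=
  !₂[x 0 * μ (x 0 ^ 2 + x 1 ^ 2), x 1 * μ (x 0 ^ 2 + x 1 ^ 2), F (x 0 ^ 2 + x 1 ^ 2),
    G (x 0 ^ 2 + x 1 ^ 2)]

theorem EuclideanSpace.norm_sq_fin_two (x : EuclideanSpace ℝ (Fin 2)) :
    ‖x‖ ^ 2 = x 0 ^ 2 + x 1 ^ 2 := by
  simp [EuclideanSpace.norm_sq_eq, Fin.sum_univ_two]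

theorem EuclideanSpace.norm_sq_fin_four (x : EuclideanSpace ℝ (Fin 4)) :
    ‖x‖ ^ 2 = x 0 ^ 2 + x 1 ^ 2 + x 2 ^ 2 + x 3 ^ 2 := by
  simp [EuclideanSpace.norm_sq_eq, Fin.sum_univ_four]

theorem mem_range_revolutionSurface {F G μ : ℝ → ℝ} (hμ : ∀ τ, 0 ≤ τ → 0 < μ τ)
    {q : EuclideanSpace ℝ (Fin 4)} : q ∈ range (revolutionSurface F G μ) ↔
      ∃ τ, 0 ≤ τ ∧ q 2 = F τ ∧ q 3 = G τ ∧ q 0 ^ 2 + q 1 ^ 2 = τ * μ τ ^ 2 := by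
  constructor
  · rintro ⟨x, rfl⟩
    refine ⟨x 0 ^ 2 + x 1 ^ 2, by positivity, rfl, rfl, ?_⟩
    simp only [revolutionSurface, Matrix.cons_val]
    ring
  · rintro ⟨τ, hτ, h2, h3, h01⟩
    have hm := (hμ τ hτ).ne'
    have hsq : (q 0 / μ τ) ^ 2 + (q 1 / μ τ) ^ 2 = τ := by
      field_simp
      rw [h01]
      ring
    refine ⟨!₂[q 0 / μ τ, q 1 / μ τ], ?_⟩
    ext i
    fin_cases i <;> simp [revolutionSurface, hsq, h2, h3, hm]

theorem contDiff_revolutionSurface {F G μ : ℝ → ℝ} (hF : ContDiff ℝ ∞ F) (hG : ContDiff ℝ ∞ G)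
    (hμ : ContDiff ℝ ∞ μ) : ContDiff ℝ ∞ (revolutionSurface F G μ) := by
  have hc : ∀ i : Fin 2, ContDiff ℝ ∞ fun x : EuclideanSpace ℝ (Fin 2) => x i := fun i => by
    fun_prop
  have hs : ContDiff ℝ ∞ fun x : EuclideanSpace ℝ (Fin 2) => x 0 ^ 2 + x 1 ^ 2 :=
    ((hc 0).pow 2).add ((hc 1).pow 2)
  rw [contDiff_euclidean]
  intro i
  fin_cases i
  · exact (hc 0).mul (hμ.comp hs)
  · exact (hc 1).mul (hμ.comp hs)
  · exact hF.comp hs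
  · exact hG.comp hs

/-- The hypotheses concern the profile `(√τ μ, F, G)`: `μ + 2τμ'` is `2√τ` times the derivative of
its radius, and `hinj` compares squared radii. No immersion condition is needed at `τ = 0`, where
the first two coordinates already have differential `μ(0)` times the identity. -/
theorem isProperSmoothEmbedding_revolutionSurface {F G μ : ℝ → ℝ} (hF : ContDiff ℝ ∞ F)
    (hG : ContDiff ℝ ∞ G) (hμ : ContDiff ℝ ∞ μ) (hpos : ∀ τ, 0 ≤ τ → 0 < μ τ)
    (himm : ∀ τ, 0 < τ → deriv F τ = 0 → deriv G τ = 0 → μ τ + 2 * τ * deriv μ τ ≠ 0)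
    (hinj : ∀ τ, 0 ≤ τ → ∀ ρ, 0 ≤ ρ → F τ = F ρ → G τ = G ρ → τ * μ τ ^ 2 = ρ * μ ρ ^ 2 → τ = ρ)
    (hprop : Tendsto (fun τ => τ * μ τ ^ 2) atTop atTop) :
    IsProperSmoothEmbedding (revolutionSurface F G μ) := by
  have hsmooth := contDiff_revolutionSurface hF hG hμ
  refine ⟨hsmooth, fun x => ?_, ?_⟩
  · refine (injective_iff_map_eq_zero _).2 fun w hw => ?_
    have hline : HasDerivAt (fun t : ℝ => x + t • w) w 0 := by
      simpa using ((hasDerivAt_id (0 : ℝ)).smul_const w).const_add x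
    have hd : HasDerivAt (fun t : ℝ => revolutionSurface F G μ (x + t • w)) 0 0 := by
      have h1 := (hsmooth.differentiable (by simp) (x + (0 : ℝ) • w)).hasFDerivAt
      have h2 := h1.comp_hasDerivAt (0 : ℝ) hline
      have h3 : x + (0 : ℝ) • w = x := by simp
      rw [h3] at h2
      rwa [hw] at h2
    have hcomp : ∀ i, HasDerivAt (fun t : ℝ => revolutionSurface F G μ (x + t • w) i) 0 0 :=
      fun i => ((EuclideanSpace.proj i : EuclideanSpace ℝ (Fin 4) →L[ℝ] ℝ).hasFDerivAt
        |>.comp_hasDerivAt (0 : ℝ) hd).congr_deriv (by simp)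
    set τ := x 0 ^ 2 + x 1 ^ 2 with hτ
    set p := x 0 * w 0 + x 1 * w 1 with hp
    have hcoord : ∀ i : Fin 2, HasDerivAt (fun t : ℝ => x i + t * w i) (w i) 0 := fun i => by
      simpa using ((hasDerivAt_id (0 : ℝ)).mul_const (w i)).const_add (x i)
    have hsq : HasDerivAt (fun t : ℝ => (x 0 + t * w 0) ^ 2 + (x 1 + t * w 1) ^ 2) (2 * p) 0 := by
      refine (((hcoord 0).pow 2).add ((hcoord 1).pow 2)).congr_deriv ?_
      simp [hp]
      ring
    have hchain : ∀ {u : ℝ → ℝ}, ContDiff ℝ ∞ u →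
        HasDerivAt (fun t : ℝ => u ((x 0 + t * w 0) ^ 2 + (x 1 + t * w 1) ^ 2))
          (deriv u τ * (2 * p)) 0 := by
      intro u hu
      have h1 : HasDerivAt u (deriv u τ)
          ((x 0 + (0 : ℝ) * w 0) ^ 2 + (x 1 + (0 : ℝ) * w 1) ^ 2) := by
        simpa [hτ] using (hu.differentiable (by simp) τ).hasDerivAt
      exact h1.comp (0 : ℝ) hsq
    have e2 : deriv F τ * (2 * p) = 0 := (hchain hF).unique (hcomp 2)
    have e3 : deriv G τ * (2 * p) = 0 := (hchain hG).unique (hcomp 3)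
    have e0 : w 0 * μ τ + x 0 * (deriv μ τ * (2 * p)) = 0 := by
      have := ((hcoord 0).mul (hchain hμ)).unique (hcomp 0)
      simpa [hτ] using this
    have e1 : w 1 * μ τ + x 1 * (deriv μ τ * (2 * p)) = 0 := by
      have := ((hcoord 1).mul (hchain hμ)).unique (hcomp 1)
      simpa [hτ] using this
    have hτ0 : 0 ≤ τ := by positivity
    -- If `p ≠ 0`, then `F' = G' = 0`, and pairing the first two components with `x` gives `p (μ +
    -- 2τμ') = 0`, against `himm`. With `p = 0` those components reduce to `μ w = 0`.
    have hp0 : p = 0 := by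
      rcases hτ0.eq_or_lt with h | h
      · have hx0 : x 0 = 0 := by nlinarith [sq_nonneg (x 0), sq_nonneg (x 1)]
        have hx1 : x 1 = 0 := by nlinarith [sq_nonneg (x 0), sq_nonneg (x 1)]
        rw [hp, hx0, hx1]
        ring
      · by_contra hne
        have h2p : 2 * p ≠ 0 := mul_ne_zero two_ne_zero hne
        refine himm τ h ((mul_eq_zero.1 e2).resolve_right h2p)
          ((mul_eq_zero.1 e3).resolve_right h2p) (mul_left_cancel₀ hne ?_)
        linear_combination x 0 * e0 + x 1 * e1
    have hm := (hpos τ hτ0).ne'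
    rw [hp0] at e0 e1
    simp only [mul_zero, add_zero, mul_eq_zero, hm, or_false] at e0 e1
    ext i
    fin_cases i
    exacts [e0, e1]
  · refine .of_continuous_injective_isClosedMap hsmooth.continuous ?_ ?_
    · intro x y hxy
      have h0 : x 0 * μ (x 0 ^ 2 + x 1 ^ 2) = y 0 * μ (y 0 ^ 2 + y 1 ^ 2) :=
        congrArg (fun q => q 0) hxy
      have h1 : x 1 * μ (x 0 ^ 2 + x 1 ^ 2) = y 1 * μ (y 0 ^ 2 + y 1 ^ 2) :=
        congrArg (fun q => q 1) hxy
      have hτ := hinj _ (by positivity) _ (by positivity) (congrArg (fun q => q 2) hxy)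
        (congrArg (fun q => q 3) hxy) (by
          linear_combination (x 0 * μ (x 0 ^ 2 + x 1 ^ 2) + y 0 * μ (y 0 ^ 2 + y 1 ^ 2)) * h0 +
            (x 1 * μ (x 0 ^ 2 + x 1 ^ 2) + y 1 * μ (y 0 ^ 2 + y 1 ^ 2)) * h1)
      rw [hτ] at h0 h1
      have hm := (hpos (y 0 ^ 2 + y 1 ^ 2) (by positivity)).ne'
      ext i
      fin_cases i
      exacts [mul_right_cancel₀ hm h0, mul_right_cancel₀ hm h1]
    · refine IsProperMap.isClosedMap (isProperMap_iff_tendsto_cocompact.2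
        ⟨hsmooth.continuous, ?_⟩)
      rw [← Metric.cobounded_eq_cocompact, ← Metric.cobounded_eq_cocompact,
        ← tendsto_norm_atTop_iff_cobounded]
      have h1 : Tendsto (fun x : EuclideanSpace ℝ (Fin 2) => ‖x‖ ^ 2) (Bornology.cobounded _)
          atTop := (tendsto_pow_atTop two_ne_zero).comp tendsto_norm_cobounded_atTop
      have h2 := hprop.comp h1
      have h3 : Tendsto (fun x => ‖revolutionSurface F G μ x‖ ^ 2) (Bornology.cobounded _)
          atTop := by
        refine tendsto_atTop_mono (fun x => ?_) h2
        simp only [Function.comp, EuclideanSpace.norm_sq_fin_two, EuclideanSpace.norm_sq_fin_four,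
          revolutionSurface, Matrix.cons_val]
        nlinarith [sq_nonneg (F (x 0 ^ 2 + x 1 ^ 2)), sq_nonneg (G (x 0 ^ 2 + x 1 ^ 2))]
      refine (Real.tendsto_sqrt_atTop.comp h3).congr fun x => ?_
      simp [Real.sqrt_sq]

/-! ### Radial stretching and exchange of the coordinate planes -/

/-- The map of `ℝ⁴` that multiplies the first two coordinates, at distance `r` from the plane
`{(0, 0, z, w)}`, by `1 - u + u l r`. -/
noncomputable def radialStretch (l u : ℝ) (q : EuclideanSpace ℝ (Fin 4)) : EuclideanSpace ℝ (Fin 4) :=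
  !₂[(1 - u + u * l * √(q 0 ^ 2 + q 1 ^ 2)) * q 0, (1 - u + u * l * √(q 0 ^ 2 + q 1 ^ 2)) * q 1,
    q 2, q 3]

theorem continuous_radialStretch (l : ℝ) :
    Continuous fun p : I × EuclideanSpace ℝ (Fin 4) => radialStretch l p.1 p.2 := by
  unfold radialStretch
  exact Continuous.vec4 (by fun_prop) (by fun_prop) (by fun_prop) (by fun_prop)

/-- Radii are mapped by `r ↦ (1 - v) r + v l r²`, an increasing bijection of the half line even at
`v = 1`, where it is the squaring whose inverse supplies the square root. -/
theorem isHomeomorph_radialStretch {l : ℝ} (hl : 0 < l) {v : ℝ} (hv : v ∈ I) :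
    IsHomeomorph (radialStretch l v) := by
  have hu0 : 0 ≤ v := hv.1
  have hu1 : 0 ≤ 1 - v := sub_nonneg.2 hv.2
  let c : ℝ → ℝ := fun r => 1 - v + v * l * r
  have hc0 : ∀ r, 0 ≤ r → 0 ≤ c r := fun r hr => by positivity
  -- Completing the square in `l r² - r` bounds the loss of radius by `1 / (4l)`; this gives both
  -- properness and surjectivity.
  have hcr : ∀ r, 0 ≤ r → r - 1 / (4 * l) ≤ c r * r := fun r hr => by
    have h1 : l * r ^ 2 - r + 1 / (4 * l) = l * (r - 1 / (2 * l)) ^ 2 := by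
      field_simp
      ring
    have h2 : 0 ≤ l * (r - 1 / (2 * l)) ^ 2 := by positivity
    have h3 : 0 ≤ 1 / (4 * l) := by positivity
    have h4 : c r * r = (1 - v) * r + v * (l * r ^ 2) := by simp only [c]; ring
    rw [h4]
    nlinarith
  have hmono : ∀ r s, 0 ≤ r → r < s → c r * r < c s * s := fun r s hr hrs => by
    have hvl : 0 ≤ v * l := by positivity
    have hs : 0 < s := hr.trans_lt hrs
    have h2 : r * r < s * s := by nlinarith
    rcases hu1.eq_or_lt with h | h
    · have hv1 : v = 1 := by linarith
      have h3 : l * (r * r) < l * (s * s) := by gcongr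
      simp only [c, hv1]
      linarith
    · have h1 : (1 - v) * r < (1 - v) * s := by gcongr
      have h3 : v * l * (r * r) ≤ v * l * (s * s) := by gcongr
      simp only [c]
      linarith
  have hinjr : ∀ r s, 0 ≤ r → 0 ≤ s → c r * r = c s * s → r = s := fun r s hr hs h => by
    rcases lt_trichotomy r s with h' | h' | h'
    · exact absurd h (hmono r s hr h').ne
    · exact h'
    · exact absurd h (hmono s r hs h').ne'
  have hsqrt : ∀ k a b : ℝ, 0 ≤ k → √((k * a) ^ 2 + (k * b) ^ 2) = k * √(a ^ 2 + b ^ 2) := by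
    intro k a b hk
    rw [mul_pow, mul_pow, ← mul_add, Real.sqrt_mul (by positivity), Real.sqrt_sq hk]
  have hcont : Continuous (radialStretch l v) :=
    (continuous_radialStretch l).comp (Continuous.prodMk_right (⟨v, hv⟩ : I))
  rw [isHomeomorph_iff_continuous_isClosedMap_bijective]
  refine ⟨hcont, ?_, ?_, ?_⟩
  · refine IsProperMap.isClosedMap (isProperMap_iff_tendsto_cocompact.2 ⟨hcont, ?_⟩)
    rw [← Metric.cobounded_eq_cocompact, ← tendsto_norm_atTop_iff_cobounded]
    refine tendsto_atTop_mono (fun q => ?_)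
      (tendsto_atTop_add_const_right _ (-(1 / (4 * l))) tendsto_norm_cobounded_atTop)
    set r := √(q 0 ^ 2 + q 1 ^ 2) with hr
    have hr0 : 0 ≤ r := Real.sqrt_nonneg _
    have hr2 : r ^ 2 = q 0 ^ 2 + q 1 ^ 2 := Real.sq_sqrt (by positivity)
    have h1 : ‖radialStretch l v q‖ ^ 2 = (c r * r) ^ 2 + q 2 ^ 2 + q 3 ^ 2 := by
      rw [EuclideanSpace.norm_sq_fin_four]
      simp only [radialStretch, Matrix.cons_val, ← hr, mul_pow, hr2, c]
      ring
    have h2 : ‖q‖ ^ 2 = r ^ 2 + q 2 ^ 2 + q 3 ^ 2 := by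
      rw [EuclideanSpace.norm_sq_fin_four, hr2]
    set k := 1 / (4 * l) with hk
    have hk0 : 0 ≤ k := by positivity
    have hcr0 : 0 ≤ c r * r := mul_nonneg (hc0 r hr0) hr0
    have h3 : c r * r ≤ ‖radialStretch l v q‖ := by
      refine (sq_le_sq₀ (by positivity) (by positivity)).1 ?_
      rw [h1]
      nlinarith [sq_nonneg (q 2), sq_nonneg (q 3)]
    have h4 : ‖q‖ ≤ ‖radialStretch l v q‖ + k := by
      refine (sq_le_sq₀ (by positivity) (by positivity)).1 ?_
      rw [h2, add_sq, h1]
      have h5 : r ≤ c r * r + k := by linarith [hcr r hr0]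
      have h6 : r ^ 2 ≤ (c r * r + k) ^ 2 := by gcongr
      nlinarith
    linarith
  · intro q q' hq
    have h0 : c (√(q 0 ^ 2 + q 1 ^ 2)) * q 0 = c (√(q' 0 ^ 2 + q' 1 ^ 2)) * q' 0 :=
      congrArg (fun x => x 0) hq
    have h1 : c (√(q 0 ^ 2 + q 1 ^ 2)) * q 1 = c (√(q' 0 ^ 2 + q' 1 ^ 2)) * q' 1 :=
      congrArg (fun x => x 1) hq
    have h2 : q 2 = q' 2 := congrArg (fun x => x 2) hq
    have h3 : q 3 = q' 3 := congrArg (fun x => x 3) hq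
    have hr : √(q 0 ^ 2 + q 1 ^ 2) = √(q' 0 ^ 2 + q' 1 ^ 2) := by
      refine hinjr _ _ (Real.sqrt_nonneg _) (Real.sqrt_nonneg _) ?_
      rw [← hsqrt _ _ _ (hc0 _ (Real.sqrt_nonneg _)), h0, h1,
        hsqrt _ _ _ (hc0 _ (Real.sqrt_nonneg _))]
    rw [hr] at h0 h1
    -- The factor can vanish only for `v = 1` on the axis plane, where both points have zero first
    -- coordinates.
    rcases (hc0 _ (Real.sqrt_nonneg (q' 0 ^ 2 + q' 1 ^ 2))).eq_or_lt with h4 | h4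
    · have h5 : √(q' 0 ^ 2 + q' 1 ^ 2) = 0 := by
        have hz : c 0 * 0 = c (√(q' 0 ^ 2 + q' 1 ^ 2)) * √(q' 0 ^ 2 + q' 1 ^ 2) := by
          rw [← h4]; ring
        exact (hinjr _ _ le_rfl (Real.sqrt_nonneg _) hz).symm
      have key : ∀ x y : ℝ, √(x ^ 2 + y ^ 2) = 0 → x = 0 ∧ y = 0 := fun x y hxy => by
        rw [Real.sqrt_eq_zero (by positivity)] at hxy
        constructor <;> nlinarith [sq_nonneg x, sq_nonneg y]
      obtain ⟨a0, a1⟩ := key _ _ (hr.trans h5)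
      obtain ⟨b0, b1⟩ := key _ _ h5
      ext i
      fin_cases i
      exacts [a0.trans b0.symm, a1.trans b1.symm, h2, h3]
    · ext i
      fin_cases i
      exacts [mul_left_cancel₀ h4.ne' h0, mul_left_cancel₀ h4.ne' h1, h2, h3]
  · intro y
    set r' := √(y 0 ^ 2 + y 1 ^ 2) with hr'
    have hr'0 : 0 ≤ r' := Real.sqrt_nonneg _
    have hk0 : 0 ≤ 1 / (4 * l) := by positivity
    obtain ⟨r, hr, hrr⟩ : ∃ r ∈ Icc 0 (r' + 1 / (4 * l)), c r * r = r' := by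
      refine intermediate_value_Icc (by positivity)
        (Continuous.continuousOn (by fun_prop)) ⟨?_, ?_⟩
      · simpa using hr'0
      · have := hcr (r' + 1 / (4 * l)) (by positivity)
        linarith
    rcases (hc0 r hr.1).eq_or_lt with h | h
    · have hz : r' = 0 := by rw [← hrr, ← h, zero_mul]
      rw [hr', Real.sqrt_eq_zero (by positivity)] at hz
      have hy0 : y 0 = 0 := by nlinarith [sq_nonneg (y 0), sq_nonneg (y 1)]
      have hy1 : y 1 = 0 := by nlinarith [sq_nonneg (y 0), sq_nonneg (y 1)]
      refine ⟨!₂[0, 0, y 2, y 3], ?_⟩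
      ext i
      fin_cases i <;> simp [radialStretch, hy0, hy1]
    · have h1 : √(((c r)⁻¹ * y 0) ^ 2 + ((c r)⁻¹ * y 1) ^ 2) = r := by
        rw [hsqrt _ _ _ (by positivity), ← hr', ← hrr]
        field_simp
      refine ⟨!₂[(c r)⁻¹ * y 0, (c r)⁻¹ * y 1, y 2, y 3], ?_⟩
      have h2 : 1 - v + v * l * r = c r := rfl
      ext i
      fin_cases i <;> simp [radialStretch, h1, h2, h.ne']

theorem ambientIsotopic_radialStretch {l : ℝ} (hl : 0 < l) (A : Set (EuclideanSpace ℝ (Fin 4))) :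
    AmbientIsotopic A (radialStretch l 1 '' A) := by
  refine ⟨fun p => radialStretch l p.1 p.2, continuous_radialStretch l,
    fun u => isHomeomorph_radialStretch hl u.2, fun q => ?_, by simp⟩
  ext i
  fin_cases i <;> simp [radialStretch]

/-- The rotation of `ℝ⁴` that exchanges the two coordinate planes. -/
theorem ambientIsotopic_exchange (A : Set (EuclideanSpace ℝ (Fin 4))) :
    AmbientIsotopic A ((fun q => !₂[q 2, q 3, -q 0, -q 1]) '' A) := by
  have h1 : ∀ B : Set (EuclideanSpace ℝ (Fin 4)), AmbientIsotopic B
      ((fun q => q + !₂[q 2, q 3, 0, 0]) '' B) := fun B =>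
    AmbientIsotopic.of_shear (fun q : EuclideanSpace ℝ (Fin 4) => !₂[q 2, q 3, 0, 0])
      (Continuous.vec4 (by fun_prop) (by fun_prop) (by fun_prop) (by fun_prop))
      (fun c x => by simp) rfl
  have h2 : ∀ B : Set (EuclideanSpace ℝ (Fin 4)), AmbientIsotopic B
      ((fun q => q + !₂[0, 0, -q 0, -q 1]) '' B) := fun B =>
    AmbientIsotopic.of_shear (fun q : EuclideanSpace ℝ (Fin 4) => !₂[0, 0, -q 0, -q 1])
      (Continuous.vec4 (by fun_prop) (by fun_prop) (by fun_prop) (by fun_prop))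
      (fun c x => by simp) rfl
  convert (h1 A).trans ((h2 _).trans (h1 _)) using 1
  rw [image_image, image_image]
  refine image_congr fun q _ => ?_
  ext i
  fin_cases i <;> simp

/-! ### Flattening a surface of revolution at infinity -/

/-- The inverse of a function that is strictly increasing and unbounded on a half line. -/
theorem exists_continuous_inverse_of_strictMonoOn {R : ℝ → ℝ} (hR : Continuous R) {b : ℝ}
    (hmono : StrictMonoOn R (Ici b)) (hlim : Tendsto R atTop atTop) :
    ∃ ψ : ℝ → ℝ, Continuous ψ ∧ (∀ τ, b ≤ τ → ψ (R τ) = τ) ∧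
      (∀ y, R b ≤ y → b ≤ ψ y ∧ R (ψ y) = y) ∧ ∀ y, y ≤ R b → ψ y = b := by
  -- Below `b` the function is continued by a line of slope one, which makes it a bijection of `ℝ`;
  -- its inverse is then cut off at `b`.
  let R' : ℝ → ℝ := fun τ => R (max τ b) + min (τ - b) 0
  have hR'b : ∀ τ, b ≤ τ → R' τ = R τ := fun τ hτ => by
    simp only [R', max_eq_left hτ, min_eq_right (sub_nonneg.2 hτ), add_zero]
  have hR'm : StrictMono R' := by
    intro s t hst
    simp only [R']
    rcases le_total b s with h | h
    · rw [max_eq_left h, max_eq_left (h.trans hst.le), min_eq_right (sub_nonneg.2 h),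
        min_eq_right (sub_nonneg.2 (h.trans hst.le))]
      exact add_lt_add_left (hmono h (h.trans hst.le) hst) 0
    · rw [max_eq_right h, min_eq_left (sub_nonpos.2 h)]
      rcases le_total b t with h' | h'
      · rw [max_eq_left h', min_eq_right (sub_nonneg.2 h'), add_zero]
        rcases h.eq_or_lt with rfl | h
        · simpa using hmono self_mem_Ici h' hst
        · have := hmono.monotoneOn self_mem_Ici h' h'
          linarith
      · rw [max_eq_right h', min_eq_left (sub_nonpos.2 h')]
        linarith
  have hsurj : Function.Surjective R' := by
    refine Continuous.surjective (by fun_prop) ?_ ?_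
    · refine hlim.congr' ?_
      filter_upwards [eventually_ge_atTop b] with τ hτ using (hR'b τ hτ).symm
    · refine (tendsto_atBot_add_const_left atBot (R b - b) tendsto_id).congr' ?_
      filter_upwards [eventually_le_atBot b] with τ hτ
      simp only [R', max_eq_right hτ, min_eq_left (sub_nonpos.2 hτ), id]
      ring
  let e : ℝ ≃o ℝ := hR'm.orderIsoOfSurjective R' hsurj
  have he : ∀ τ, e τ = R' τ := fun τ => rfl
  refine ⟨fun y => max (e.symm y) b, e.symm.continuous.max continuous_const, fun τ hτ => ?_,
    fun y hy => ?_, fun y hy => ?_⟩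
  · change max (e.symm (R τ)) b = τ
    rw [← hR'b τ hτ, ← he, e.symm_apply_apply, max_eq_left hτ]
  · have h1 : b ≤ e.symm y := by
      rw [e.le_symm_apply, he, hR'b b le_rfl]
      exact hy
    refine ⟨le_max_right _ _, ?_⟩
    change R (max (e.symm y) b) = y
    rw [max_eq_left h1, ← hR'b _ h1, ← he, e.apply_symm_apply]
  · refine max_eq_right ?_
    rw [e.symm_apply_le, he, hR'b b le_rfl]
    exact hy

/-- Two surfaces of revolution are ambient isotopic if they agree up to some distance and if from
there on they are graphs over the distance to the axis. -/
theorem ambientIsotopic_range_revolutionSurface {F G μ F' G' μ' : ℝ → ℝ} (hF : Continuous F)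
    (hG : Continuous G) (hμ : Continuous μ) (hF' : Continuous F') (hG' : Continuous G')
    (hμ' : Continuous μ') (hpos : ∀ τ, 0 ≤ τ → 0 < μ τ) (hpos' : ∀ τ, 0 ≤ τ → 0 < μ' τ)
    {b : ℝ} (hb : 0 ≤ b)
    (heq : ∀ τ, 0 ≤ τ → τ ≤ b → F τ = F' τ ∧ G τ = G' τ ∧ μ τ = μ' τ)
    (hmax : ∀ τ, 0 ≤ τ → τ ≤ b → τ * μ τ ^ 2 ≤ b * μ b ^ 2)
    (hmono : StrictMonoOn (fun τ => τ * μ τ ^ 2) (Ici b))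
    (hmono' : StrictMonoOn (fun τ => τ * μ' τ ^ 2) (Ici b))
    (hlim : Tendsto (fun τ => τ * μ τ ^ 2) atTop atTop)
    (hlim' : Tendsto (fun τ => τ * μ' τ ^ 2) atTop atTop) :
    AmbientIsotopic (range (revolutionSurface F G μ)) (range (revolutionSurface F' G' μ')) := by
  obtain ⟨hFb, hGb, hμb⟩ := heq b hb le_rfl
  obtain ⟨ψ, hψ, hψ1, hψ2, hψ3⟩ :=
    exists_continuous_inverse_of_strictMonoOn (by fun_prop) hmono hlim
  obtain ⟨ψ', hψ', hψ1', hψ2', hψ3'⟩ :=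
    exists_continuous_inverse_of_strictMonoOn (by fun_prop) hmono' hlim'
  rw [← hμb] at hψ2' hψ3'
  -- The displacement is parallel to the axis and depends on the radius only; it carries one outer
  -- graph to the other. Up to the radius of `b` both inverses equal `b` and it vanishes, and `hmax`
  -- keeps the common part there.
  let e : EuclideanSpace ℝ (Fin 4) → EuclideanSpace ℝ (Fin 4) := fun q =>
    !₂[0, 0, F' (ψ' (q 0 ^ 2 + q 1 ^ 2)) - F (ψ (q 0 ^ 2 + q 1 ^ 2)),
      G' (ψ' (q 0 ^ 2 + q 1 ^ 2)) - G (ψ (q 0 ^ 2 + q 1 ^ 2))]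
  have hinv : ∀ (c : ℝ) q, e (q + c • e q) = e q := fun c q => by simp [e]
  refine AmbientIsotopic.of_shear e
    (Continuous.vec4 (by fun_prop) (by fun_prop) (by fun_prop) (by fun_prop)) hinv ?_
  apply subset_antisymm
  · rintro _ ⟨q, hq, rfl⟩
    rw [mem_range_revolutionSurface hpos] at hq
    obtain ⟨τ, hτ, h2, h3, h01⟩ := hq
    rw [mem_range_revolutionSurface hpos']
    rcases le_total τ b with hle | hle
    · have hle' := h01.trans_le (hmax τ hτ hle)
      obtain ⟨e1, e2, e3⟩ := heq τ hτ hle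
      refine ⟨τ, hτ, ?_, ?_, ?_⟩
      · simp [e, hψ3 _ hle', hψ3' _ hle', hFb, h2, e1]
      · simp [e, hψ3 _ hle', hψ3' _ hle', hGb, h3, e2]
      · simp [e, h01, e3]
    · have hle' : b * μ b ^ 2 ≤ q 0 ^ 2 + q 1 ^ 2 :=
        (hmono.monotoneOn self_mem_Ici hle hle).trans_eq h01.symm
      obtain ⟨h4, h5⟩ := hψ2' _ hle'
      refine ⟨ψ' (q 0 ^ 2 + q 1 ^ 2), hb.trans h4, ?_, ?_, ?_⟩
      · simp [e, h2, h01, hψ1 τ hle]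
      · simp [e, h3, h01, hψ1 τ hle]
      · simp [e, h5]
  · intro q hq
    rw [mem_range_revolutionSurface hpos'] at hq
    obtain ⟨τ, hτ, h2, h3, h01⟩ := hq
    refine ⟨q + (-1 : ℝ) • e q, ?_, ?_⟩
    swap
    · simp only [hinv]
      simp
    rw [mem_range_revolutionSurface hpos]
    rcases le_total τ b with hle | hle
    · obtain ⟨e1, e2, e3⟩ := heq τ hτ hle
      rw [← e3] at h01
      have hle' := h01.trans_le (hmax τ hτ hle)
      refine ⟨τ, hτ, ?_, ?_, ?_⟩
      · simp [e, hψ3 _ hle', hψ3' _ hle', hFb, h2, e1]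
      · simp [e, hψ3 _ hle', hψ3' _ hle', hGb, h3, e2]
      · simp [e, h01]
    · have hle' : b * μ b ^ 2 ≤ q 0 ^ 2 + q 1 ^ 2 := by
        rw [h01, hμb]
        exact hmono'.monotoneOn self_mem_Ici hle hle
      obtain ⟨h4, h5⟩ := hψ2 _ hle'
      refine ⟨ψ (q 0 ^ 2 + q 1 ^ 2), hb.trans h4, ?_, ?_, ?_⟩
      · simp [e, h2, h01, hψ1' τ hle]
      · simp [e, h3, h01, hψ1' τ hle]
      · simp [e, h5]

theorem strictMonoOn_mul_sq {μ : ℝ → ℝ} (hpos : ∀ τ, 0 < μ τ) {b : ℝ} (hb : 0 ≤ b)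
    (hmono : MonotoneOn μ (Ici b)) : StrictMonoOn (fun τ => τ * μ τ ^ 2) (Ici b) := by
  intro s hs t ht hst
  have h1 := hmono hs ht hst.le
  have h2 := hpos s
  have h3 : 0 ≤ s := hb.trans hs
  have h4 : μ s ^ 2 ≤ μ t ^ 2 := by gcongr
  have h5 : 0 < μ s ^ 2 := by positivity
  calc s * μ s ^ 2 < t * μ s ^ 2 := by gcongr
    _ ≤ t * μ t ^ 2 := by gcongr; linarith

theorem tendsto_mul_sq {μ : ℝ → ℝ} (hpos : ∀ τ, 0 < μ τ) {b : ℝ} (hb : 0 ≤ b)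
    (hmono : MonotoneOn μ (Ici b)) : Tendsto (fun τ => τ * μ τ ^ 2) atTop atTop := by
  have h0 := hpos b
  refine tendsto_atTop_mono' _ ?_ (tendsto_id.atTop_mul_const (pow_pos h0 2))
  filter_upwards [eventually_ge_atTop b] with τ hτ
  have h1 := hmono self_mem_Ici hτ hτ
  have h2 : 0 ≤ τ := hb.trans hτ
  simp only [id]
  gcongr

/-- A surface of revolution whose profile eventually moves away from the axis is, up to a scaling,
ambient isotopic to a long 2-knot. -/
theorem exists_isLongTwoKnot_of_revolutionSurface {F G μ : ℝ → ℝ} (hF : ContDiff ℝ ∞ F)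
    (hG : ContDiff ℝ ∞ G) (hμ : ContDiff ℝ ∞ μ) (hpos : ∀ τ, 0 < μ τ)
    (himm : ∀ τ, 0 < τ → deriv F τ = 0 → deriv G τ = 0 → μ τ + 2 * τ * deriv μ τ ≠ 0)
    (hinj : ∀ τ, 0 ≤ τ → ∀ ρ, 0 ≤ ρ → F τ = F ρ → G τ = G ρ → τ * μ τ ^ 2 = ρ * μ ρ ^ 2 → τ = ρ)
    {b₀ : ℝ} (hb₀ : 0 ≤ b₀) (hmono : MonotoneOn μ (Ici b₀)) :
    ∃ κ, 0 < κ ∧ ∃ L, IsLongTwoKnot L ∧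
      AmbientIsotopic (range (revolutionSurface F G fun τ => κ * μ τ)) (range L) := by
  have hlim := tendsto_mul_sq hpos hb₀ hmono
  have hμc := hμ.continuous
  obtain ⟨B, hB⟩ := (isCompact_Icc (a := (0 : ℝ)) (b := b₀)).bddAbove_image
    (f := fun τ => τ * μ τ ^ 2) (Continuous.continuousOn (by fun_prop))
  -- At `b` the surface is at least as far from the axis as anywhere before.
  obtain ⟨b, hbB, hbb⟩ := ((hlim.eventually (eventually_ge_atTop B)).and
    (eventually_gt_atTop b₀)).exists
  have hb : 0 < b := hb₀.trans_lt hbb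
  have hmax : ∀ τ, 0 ≤ τ → τ ≤ b → τ * μ τ ^ 2 ≤ b * μ b ^ 2 := fun τ hτ hτb => by
    rcases le_total τ b₀ with h | h
    · exact (hB ⟨τ, ⟨hτ, h⟩, rfl⟩).trans hbB
    · exact (strictMonoOn_mul_sq hpos hb₀ hmono).monotoneOn h hbb.le hτb
  -- With this scale `κ μ ≤ 1` on `[b₀, b + 1]`, so the blend of `κ μ` into the constant `1` stays
  -- nondecreasing.
  set κ := (μ (b + 1))⁻¹ with hκ
  have hκ0 : 0 < κ := inv_pos.2 (hpos _)
  let χ : ℝ → ℝ := fun τ => Real.smoothTransition (τ - b)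
  have hχ : ContDiff ℝ ∞ χ :=
    Real.smoothTransition.contDiff.comp (contDiff_id.sub contDiff_const)
  have hχ0 : ∀ τ, τ ≤ b → χ τ = 0 := fun τ h =>
    Real.smoothTransition.zero_of_nonpos (sub_nonpos.2 h)
  have hχ1 : ∀ τ, b + 1 ≤ τ → χ τ = 1 := fun τ h =>
    Real.smoothTransition.one_of_one_le (by linarith)
  have hχn : ∀ τ, 0 ≤ χ τ := fun τ => Real.smoothTransition.nonneg _
  have hχl : ∀ τ, χ τ ≤ 1 := fun τ => Real.smoothTransition.le_one _
  have hχm : Monotone χ := fun s t h => Real.smoothTransition.monotone (by linarith)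
  let F' : ℝ → ℝ := fun τ => (1 - χ τ) * F τ
  let G' : ℝ → ℝ := fun τ => (1 - χ τ) * G τ
  let ν : ℝ → ℝ := fun τ => (1 - χ τ) * (κ * μ τ) + χ τ
  have hF' : ContDiff ℝ ∞ F' := (contDiff_const.sub hχ).mul hF
  have hG' : ContDiff ℝ ∞ G' := (contDiff_const.sub hχ).mul hG
  have hν : ContDiff ℝ ∞ ν := ((contDiff_const.sub hχ).mul (contDiff_const.mul hμ)).add hχ
  have hκμ : ∀ τ, 0 < κ * μ τ := fun τ => mul_pos hκ0 (hpos τ)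
  have hνpos : ∀ τ, 0 < ν τ := fun τ => by
    have h1 := hκμ τ
    rcases (hχn τ).eq_or_lt with h | h
    · simpa [ν, ← h] using h1
    · have := mul_nonneg (sub_nonneg.2 (hχl τ)) h1.le
      simp only [ν]
      linarith
  have hFb : ∀ τ, τ ≤ b → F' τ = F τ := fun τ h => by simp [F', hχ0 τ h]
  have hGb : ∀ τ, τ ≤ b → G' τ = G τ := fun τ h => by simp [G', hχ0 τ h]
  have hνb : ∀ τ, τ ≤ b → ν τ = κ * μ τ := fun τ h => by simp [ν, hχ0 τ h]
  have hκle : ∀ τ, b₀ ≤ τ → τ ≤ b + 1 → κ * μ τ ≤ 1 := fun τ h h' => by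
    rw [hκ, inv_mul_le_iff₀ (hpos _), mul_one]
    exact hmono h (h.trans h') h'
  have hνmono : MonotoneOn ν (Ici b₀) := by
    intro s hs t ht hst
    rcases le_total t (b + 1) with h | h
    · have h1 := hκle s hs (hst.trans h)
      have h2 : κ * μ s ≤ κ * μ t := by
        have := hmono hs ht hst
        gcongr
      have h3 := hχm hst
      have h4 := mul_le_mul_of_nonneg_left h2 (sub_nonneg.2 (hχl t))
      have h5 := mul_nonneg (sub_nonneg.2 h3) (sub_nonneg.2 h1)
      simp only [ν]
      nlinarith
    · have h1 : ν t = 1 := by simp [ν, hχ1 t h]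
      rw [h1]
      rcases le_total s (b + 1) with h2 | h2
      · have h3 := mul_le_mul_of_nonneg_left (hκle s hs h2) (sub_nonneg.2 (hχl s))
        simp only [ν]
        linarith
      · simp [ν, hχ1 s h2]
  have hκmono : MonotoneOn (fun τ => κ * μ τ) (Ici b₀) := fun s hs t ht hst =>
    mul_le_mul_of_nonneg_left (hmono hs ht hst) hκ0.le
  have hmem : Ici b ⊆ Ici b₀ := Ici_subset_Ici.2 hbb.le
  have hκsq : ∀ τ, τ * (κ * μ τ) ^ 2 = κ ^ 2 * (τ * μ τ ^ 2) := fun τ => by ring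
  have hκ2 : 0 < κ ^ 2 := by positivity
  have hνs := strictMonoOn_mul_sq hνpos hb.le (hνmono.mono hmem)
  have hνl := tendsto_mul_sq hνpos hb₀ hνmono
  refine ⟨κ, hκ0, revolutionSurface F' G' ν, ⟨?_, ?_⟩, ?_⟩
  · refine isProperSmoothEmbedding_revolutionSurface hF' hG' hν (fun τ _ => hνpos τ) ?_ ?_ hνl
    · intro τ hτ h1 h2
      rcases lt_or_ge τ b with h | h
      · have hnear : ∀ᶠ x in 𝓝 τ, x ≤ b := Iic_mem_nhds h
        have e1 : F' =ᶠ[𝓝 τ] F := hnear.mono hFb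
        have e2 : G' =ᶠ[𝓝 τ] G := hnear.mono hGb
        have e3 : ν =ᶠ[𝓝 τ] fun x => κ * μ x := hnear.mono hνb
        rw [e1.deriv_eq] at h1
        rw [e2.deriv_eq] at h2
        rw [e3.deriv_eq, hνb τ h.le, deriv_const_mul _ (hμ.differentiable (by simp) τ)]
        have h3 := mul_ne_zero hκ0.ne' (himm τ hτ h1 h2)
        convert h3 using 1
        ring
      · have h3 : 0 ≤ deriv ν τ := by
          rw [← derivWithin_of_mem_nhds (Ici_mem_nhds (hbb.trans_le h))]
          exact hνmono.derivWithin_nonneg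
        have h4 := hνpos τ
        positivity
    -- Beyond `b` the radius exceeds every radius before it, so a coincidence with a parameter up to
    -- `b` takes place within the unmodified part.
    · have key : ∀ τ, 0 ≤ τ → τ ≤ b → ∀ ρ, 0 ≤ ρ → F' τ = F' ρ → G' τ = G' ρ →
          τ * ν τ ^ 2 = ρ * ν ρ ^ 2 → τ = ρ := by
        intro τ hτ hτb ρ hρ h1 h2 h3
        have hρb : ρ ≤ b := by
          by_contra! hlt
          have h4 := hνs self_mem_Ici hlt.le hlt
          simp only at h4
          rw [← h3, hνb τ hτb, hνb b le_rfl, hκsq, hκsq] at h4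
          have h5 := hmax τ hτ hτb
          nlinarith
        rw [hFb τ hτb, hFb ρ hρb] at h1
        rw [hGb τ hτb, hGb ρ hρb] at h2
        rw [hνb τ hτb, hνb ρ hρb, hκsq, hκsq] at h3
        exact hinj τ hτ ρ hρ h1 h2 (mul_left_cancel₀ hκ2.ne' h3)
      intro τ hτ ρ hρ h1 h2 h3
      rcases le_total τ b with h | h
      · exact key τ hτ h ρ hρ h1 h2 h3
      rcases le_total ρ b with h' | h'
      · exact (key ρ hρ h' τ hτ h1.symm h2.symm h3.symm).symm
      · exact hνs.injOn h h' h3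
  · refine ⟨Metric.closedBall 0 (b + 2), isCompact_closedBall _ _, fun x hx => ?_⟩
    rw [mem_closedBall_zero_iff, not_le] at hx
    have h1 : b + 1 ≤ x 0 ^ 2 + x 1 ^ 2 := by
      rw [← EuclideanSpace.norm_sq_fin_two]
      nlinarith
    simp [revolutionSurface, F', G', ν, hχ1 _ h1]
  · refine ambientIsotopic_range_revolutionSurface hF.continuous hG.continuous
      (continuous_const.mul hμc) hF'.continuous hG'.continuous hν.continuous
      (fun τ _ => hκμ τ) (fun τ _ => hνpos τ) hb.le
      (fun τ _ h => ⟨(hFb τ h).symm, (hGb τ h).symm, (hνb τ h).symm⟩) (fun τ hτ h => ?_)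
      (strictMonoOn_mul_sq hκμ hb.le (hκmono.mono hmem)) hνs
      (tendsto_mul_sq hκμ hb₀ hκmono) hνl
    rw [hκsq, hκsq]
    exact mul_le_mul_of_nonneg_left (hmax τ hτ h) hκ2.le

/-! ### The polynomial 2-knot -/

/-- A positive polynomial is eventually nondecreasing. -/
theorem Polynomial.exists_monotoneOn_of_pos {m : ℝ[X]} (hm : ∀ t, 0 < m.eval t) :
    ∃ b, 0 ≤ b ∧ MonotoneOn (fun t => m.eval t) (Ici b) := by
  have hlead : 0 ≤ m.leadingCoeff := by
    by_contra! h
    by_cases hd : 0 < m.degree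
    · obtain ⟨t, ht⟩ := ((m.tendsto_atBot_of_leadingCoeff_nonpos hd h.le).eventually
        (eventually_le_atBot 0)).exists
      exact absurd (hm t) (not_lt.2 ht)
    · rw [eq_C_of_degree_le_zero (not_lt.1 hd), leadingCoeff_C] at h
      have := hm 0
      rw [eq_C_of_degree_le_zero (not_lt.1 hd), eval_C] at this
      linarith
  have hlead' : 0 ≤ (derivative m).leadingCoeff := by
    rw [leadingCoeff_derivative]
    positivity
  have hev : ∀ᶠ t in atTop, 0 ≤ (derivative m).eval t := by
    by_cases hd : 0 < (derivative m).degree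
    · exact ((derivative m).tendsto_atTop_of_leadingCoeff_nonneg hd hlead').eventually
        (eventually_ge_atTop 0)
    · rw [eq_C_of_degree_le_zero (not_lt.1 hd), leadingCoeff_C] at hlead'
      rw [eq_C_of_degree_le_zero (not_lt.1 hd)]
      exact Eventually.of_forall fun t => by rwa [eval_C]
  obtain ⟨b, hb⟩ := eventually_atTop.1 hev
  refine ⟨max b 0, le_max_right _ _, monotoneOn_of_deriv_nonneg (convex_Ici _)
    m.continuous.continuousOn m.differentiable.differentiableOn fun t ht => ?_⟩
  rw [interior_Ici] at ht
  rw [Polynomial.deriv]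
  exact hb t ((le_max_left _ _).trans (mem_Ioi.1 ht).le)

/-- A surface of revolution with polynomial profile functions has polynomial coordinates. -/
theorem exists_mvPolynomial_revolutionSurface (F G M : ℝ[X]) :
    ∃ p : Fin 4 → MvPolynomial (Fin 2) ℝ, ∀ x i,
      revolutionSurface (fun τ => F.eval τ) (fun τ => G.eval τ) (fun τ => M.eval τ) x i =
        MvPolynomial.eval (fun j => x j) (p i) := by
  let s : MvPolynomial (Fin 2) ℝ := MvPolynomial.X 0 ^ 2 + MvPolynomial.X 1 ^ 2
  have key : ∀ (x : EuclideanSpace ℝ (Fin 2)) (q : ℝ[X]),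
      MvPolynomial.eval (fun j => x j) (aeval s q) = q.eval (x 0 ^ 2 + x 1 ^ 2) := by
    intro x q
    have h1 : MvPolynomial.aeval (fun j => x j) (aeval s q) =
        aeval (MvPolynomial.aeval (R := ℝ) (fun j => x j) s) q :=
      (Polynomial.aeval_algHom_apply _ _ _).symm
    simpa [s, coe_aeval_eq_eval, MvPolynomial.aeval_eq_eval] using h1
  refine ⟨![MvPolynomial.X 0 * aeval s M, MvPolynomial.X 1 * aeval s M, aeval s F, aeval s G],
    fun x i => ?_⟩
  fin_cases i <;> simp [revolutionSurface, key]

/-- The spin of an arc with height `(t - a) m(t) ^ 2` is ambient isotopic to the surface of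
revolution with profile `κ √(t - a) m(t)`. -/
theorem ambientIsotopic_spin_range_revolutionSurface {f g m : ℝ[X]} {a κ : ℝ} (hκ : 0 < κ)
    (hm : ∀ t, 0 < m.eval t) :
    AmbientIsotopic (spin (polyArc f g ((X - C a) * m ^ 2) a))
      (range (revolutionSurface (fun τ => -f.eval (τ + a)) (fun τ => -g.eval (τ + a))
        fun τ => κ * m.eval (τ + a))) := by
  -- The stretch sends the radius `κ √τ m` to `κ⁻² (κ √τ m)² = τ m²`, the height of the arc.
  have hl : 0 < (κ ^ 2)⁻¹ := by positivity
  refine (ambientIsotopic_exchange _).trans (AmbientIsotopic.symm ?_)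
  convert ambientIsotopic_radialStretch hl _ using 1
  have hheight : ∀ t, ((X - C a) * m ^ 2 : ℝ[X]).eval t = (t - a) * m.eval t ^ 2 := fun t => by
    simp
  have hnonneg : ∀ p ∈ polyArc f g ((X - C a) * m ^ 2) a, 0 ≤ p 2 := by
    rintro _ ⟨t, ht, rfl⟩
    change 0 ≤ ((X - C a) * m ^ 2 : ℝ[X]).eval t
    rw [hheight]
    exact mul_nonneg (sub_nonneg.2 ht) (sq_nonneg _)
  have hsq : ∀ (l : ℝ) (q : EuclideanSpace ℝ (Fin 4)),
      (radialStretch l 1 q 0) ^ 2 + (radialStretch l 1 q 1) ^ 2 =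
        (l * (q 0 ^ 2 + q 1 ^ 2)) ^ 2 := by
    intro l q
    have h1 : √(q 0 ^ 2 + q 1 ^ 2) ^ 2 = q 0 ^ 2 + q 1 ^ 2 := Real.sq_sqrt (by positivity)
    simp only [radialStretch, Matrix.cons_val]
    linear_combination l ^ 2 * (q 0 ^ 2 + q 1 ^ 2) * h1
  have hpos : ∀ τ, 0 ≤ τ → 0 < κ * m.eval (τ + a) := fun τ _ => mul_pos hκ (hm _)
  ext y
  constructor
  · rintro ⟨q, hq, rfl⟩
    rw [mem_spin_iff hnonneg] at hq
    obtain ⟨_, ⟨t, ht, rfl⟩, h0, h1, h2⟩ := hq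
    obtain ⟨x, hx⟩ := (isHomeomorph_radialStretch hl unitInterval.one_mem).surjective
      !₂[q 2, q 3, -q 0, -q 1]
    refine ⟨x, ?_, hx⟩
    rw [mem_range_revolutionSurface hpos]
    have h3 := hsq (κ ^ 2)⁻¹ x
    rw [hx] at h3
    have hx2 : x 2 = -q 0 := congrArg (fun x => x 2) hx
    have hx3 : x 3 = -q 1 := congrArg (fun x => x 3) hx
    refine ⟨t - a, sub_nonneg.2 ht, ?_, ?_, ?_⟩
    · rw [hx2, h0, sub_add_cancel]
      rfl
    · rw [hx3, h1, sub_add_cancel]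
      rfl
    · change _ = ((X - C a) * m ^ 2 : ℝ[X]).eval t ^ 2 at h2
      simp only [Matrix.cons_val] at h3
      rw [h2, hheight, sq_eq_sq₀ (mul_nonneg (sub_nonneg.2 ht) (sq_nonneg _)) (by positivity)] at h3
      rw [sub_add_cancel, mul_pow]
      field_simp at h3
      linarith
  · rintro ⟨x, hx, rfl⟩
    rw [mem_range_revolutionSurface hpos] at hx
    obtain ⟨τ, hτ, h2, h3, h01⟩ := hx
    have h4 := hsq (κ ^ 2)⁻¹ x
    refine ⟨!₂[-x 2, -x 3, radialStretch (κ ^ 2)⁻¹ 1 x 0, radialStretch (κ ^ 2)⁻¹ 1 x 1], ?_, ?_⟩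
    · rw [mem_spin_iff hnonneg]
      refine ⟨_, ⟨τ + a, by simpa using hτ, rfl⟩, ?_, ?_, ?_⟩
      · simp [h2, polyCurve]
      · simp [h3, polyCurve]
      · change radialStretch (κ ^ 2)⁻¹ 1 x 0 ^ 2 + radialStretch (κ ^ 2)⁻¹ 1 x 1 ^ 2 =
          ((X - C a) * m ^ 2 : ℝ[X]).eval (τ + a) ^ 2
        rw [h4, h01, hheight]
        field_simp
        ring
    · ext i
      fin_cases i <;> simp [radialStretch]

/-- The spin of a knotted arc with height `(t - a) m(t) ^ 2` is a polynomial 2-knot. -/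
theorem exists_isPolynomialTwoKnot {f g m : ℝ[X]} {a : ℝ} (hm : ∀ t, 0 < m.eval t)
    (hK : IsPolynomialKnot f g ((X - C a) * m ^ 2)) :
    ∃ P, IsPolynomialTwoKnot P ∧
      AmbientIsotopic (spin (polyArc f g ((X - C a) * m ^ 2) a)) (range P) := by
  set F : ℝ[X] := -f.comp (X + C a) with hF
  set G : ℝ[X] := -g.comp (X + C a) with hG
  set M : ℝ[X] := m.comp (X + C a) with hM
  have hFe : ∀ τ, F.eval τ = -f.eval (τ + a) := fun τ => by simp [hF]
  have hGe : ∀ τ, G.eval τ = -g.eval (τ + a) := fun τ => by simp [hG]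
  have hMe : ∀ τ, M.eval τ = m.eval (τ + a) := fun τ => by simp [hM]
  have hMpos : ∀ τ, 0 < M.eval τ := fun τ => by rw [hMe]; exact hm _
  have himm : ∀ τ, 0 < τ → deriv (fun τ => F.eval τ) τ = 0 → deriv (fun τ => G.eval τ) τ = 0 →
      M.eval τ + 2 * τ * deriv (fun τ => M.eval τ) τ ≠ 0 := by
    intro τ _ h1 h2 h3
    simp only [Polynomial.deriv] at h1 h2 h3
    refine hK.immersion (τ + a) (polyCurve_eq_zero_iff.2 ⟨?_, ?_, ?_⟩)
    · simpa [hF, derivative_comp] using h1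
    · simpa [hG, derivative_comp] using h2
    · have h4 : (derivative M).eval τ = (derivative m).eval (τ + a) := by
        simp [hM, derivative_comp]
      rw [h4, hMe] at h3
      simp only [derivative_mul, derivative_sub, derivative_X, derivative_C, derivative_pow,
        eval_add, eval_mul, eval_sub, eval_X, eval_C, eval_pow, eval_one, eval_zero]
      simp only [sub_zero, one_mul, add_sub_cancel_right, Nat.cast_ofNat,
        Nat.add_one_sub_one, pow_one]
      -- The derivative of `(t - a) m²` is `m (m + 2 (t - a) m')`, so the immersion condition of the
      -- knot is that of the profile.
      linear_combination m.eval (τ + a) * h3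
  have hinj : ∀ τ, 0 ≤ τ → ∀ ρ, 0 ≤ ρ → F.eval τ = F.eval ρ → G.eval τ = G.eval ρ →
      τ * M.eval τ ^ 2 = ρ * M.eval ρ ^ 2 → τ = ρ := by
    intro τ _ ρ _ h1 h2 h3
    rw [hFe, hFe, neg_inj] at h1
    rw [hGe, hGe, neg_inj] at h2
    rw [hMe, hMe] at h3
    have h4 := hK.injective (polyCurve_eq_iff.2 ⟨h1, h2, by simpa using h3⟩)
    linarith
  obtain ⟨b, hb, hmono⟩ := exists_monotoneOn_of_pos hMpos
  obtain ⟨κ, hκ, L, hL, hLiso⟩ := exists_isLongTwoKnot_of_revolutionSurface F.contDiff_eval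
    G.contDiff_eval M.contDiff_eval hMpos himm hinj hb hmono
  have hκmono : MonotoneOn (fun τ => κ * M.eval τ) (Ici b) := fun s hs t ht hst =>
    mul_le_mul_of_nonneg_left (hmono hs ht hst) hκ.le
  have hκpos : ∀ τ, 0 < κ * M.eval τ := fun τ => mul_pos hκ (hMpos τ)
  refine ⟨revolutionSurface (fun τ => F.eval τ) (fun τ => G.eval τ) fun τ => κ * M.eval τ,
    ⟨?_, ?_, L, hL, hLiso⟩, ?_⟩
  · simpa using exists_mvPolynomial_revolutionSurface F G (C κ * M)
  · refine isProperSmoothEmbedding_revolutionSurface F.contDiff_eval G.contDiff_eval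
      (contDiff_const.mul M.contDiff_eval) (fun τ _ => hκpos τ) ?_ ?_
      (tendsto_mul_sq hκpos hb hκmono)
    · intro τ hτ h1 h2 h3
      rw [deriv_const_mul _ M.differentiable.differentiableAt] at h3
      refine himm τ hτ h1 h2 (mul_left_cancel₀ hκ.ne' ?_)
      linear_combination h3
    · intro τ hτ ρ hρ h1 h2 h3
      refine hinj τ hτ ρ hρ h1 h2 (mul_left_cancel₀ (pow_pos hκ 2).ne' ?_)
      linear_combination h3
  · have := ambientIsotopic_spin_range_revolutionSurface (f := f) (g := g) (a := a) hκ hm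
    simpa only [hFe, hGe, hMe] using this

theorem theorem5 (f g h : ℝ[X]) (hK : IsPolynomialKnot f g h) :
    ∃ (f₁ g₁ h₁ : ℝ[X]) (a : ℝ) (P : EuclideanSpace ℝ (Fin 2) → EuclideanSpace ℝ (Fin 4)),
      -- the arc over `[a, ∞)` is a knotted arc of `K`, with one end at infinity
      IsKnottedArcOf f₁ g₁ h₁ a (range (polyCurve f g h)) ∧
      -- spinning it gives a polynomial 2-knot
      IsPolynomialTwoKnot P ∧
      AmbientIsotopic (spin (polyArc f₁ g₁ h₁ a)) (range P) ∧
      -- which is parametrized with Chebyshev approximations of sine and cosine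
      ∀ ε : ℝ, 0 < ε → ∃ N : ℕ, ∀ n : ℕ, N ≤ n → ∀ S C : ℝ[X],
        S = chebyshevApprox Real.sin 0 (2 * Real.pi) n →
        C = chebyshevApprox Real.cos 0 (2 * Real.pi) n →
        (∀ s ∈ Icc (0 : ℝ) (2 * Real.pi),
          |S.eval s - Real.sin s| < ε ∧ |C.eval s - Real.cos s| < ε) ∧
        -- the only identifications are those of the spinning construction
        (∀ t ∈ Ici a, ∀ t' ∈ Ici a, ∀ s ∈ Icc (0 : ℝ) (2 * Real.pi),
          ∀ s' ∈ Icc (0 : ℝ) (2 * Real.pi),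
          (spinParam f₁ g₁ h₁ S C (t, s) = spinParam f₁ g₁ h₁ S C (t', s') ↔
            t = t' ∧ (t = a ∨ s = s' ∨ (s = 0 ∧ s' = 2 * Real.pi) ∨
              (s = 2 * Real.pi ∧ s' = 0)))) ∧
        -- and the image is the spun surface, up to ambient isotopy
        AmbientIsotopic
          (spinParam f₁ g₁ h₁ S C '' (Ici a ×ˢ Icc (0 : ℝ) (2 * Real.pi)))
          (spin (polyArc f₁ g₁ h₁ a)) := by
  obtain ⟨f₁, g₁, m, a, hm, harc⟩ := hK.exists_isKnottedArcOf
  obtain ⟨P, hP, hPiso⟩ := exists_isPolynomialTwoKnot hm harc.arc.knot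
  exact ⟨f₁, g₁, (X - C a) * m ^ 2, a, P, harc, hP, hPiso,
    fun ε hε => harc.arc.spinParam_chebyshevApprox hε⟩
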